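/- Let $M$ be a smooth manifold and $\pi:A\to M$ a smooth real vector bundle of finite rank, with dual bundle $\pi^*:A^*\to M$. For $\mu\in\Gamma(A)$ let $\tilde\mu\in C^\infty(A^*)$ be the linear function $\tilde\mu(\alpha)=\alpha(\mu(\pi^*(\alpha)))$. A Jacobi structure on a manifold $N$ is a pair $(\Lambda,E)$ of a smooth $2$-vector field and a smooth vector field with $[\Lambda,\Lambda]_{SN}=2E\wedge\Lambda$ and $[E,\Lambda]_{SN}=0$, where $[\,,]_{SN}$ is the Schouten–Nijenhuis bracket, with the sign convention $[\Lambda,\Lambda]_{SN}(df,dg,dh)=2\sum_{\mathrm{cycl}}\Lambda(d(\Lambda(df,dg)),dh)$; its Jacobi bracket is $\{f,g\}=\Lambda(df,dg)+fE(g)-gE(f)$. The wedge product of vector fields is normalized by $(X\wedge Y)(\alpha,\beta)=\alpha(X)\beta(Y)-\alpha(Y)\beta(X)$, and $(E\wedge\Lambda)(\alpha,\beta,\gamma)=\alpha(E)\Lambda(\beta,\gamma)+\beta(E)\Lambda(\gamma,\alpha)+\gamma(E)\Lambda(\alpha,\beta)$. A Lie algebroid structure on $A$ is a pair $([\![\,,]\!],\rho)$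 of a real Lie algebra bracket on $\Gamma(A)$ and a vector bundle map $\rho:A\to TM$ over the identity such that $\rho[\![\mu,\eta]\!]=[\rho(\mu),\rho(\eta)]$ and $[\![\mu,f\eta]\!]=f[\![\mu,\eta]\!]+(\rho(\mu)f)\eta$ for all $\mu,\eta\in\Gamma(A)$, $f\in C^\infty(M)$. A section $\phi\in\Gamma(A^*)$ is a $1$-cocycle if $\phi[\![\mu,\eta]\!]=\rho(\mu)(\phi(\eta))-\rho(\eta)(\phi(\mu))$ for all $\mu,\eta\in\Gamma(A)$. Let $(A,[\![\,,]\!],\rho)$ be a Lie algebroid over $M$ and $\phi\in\Gamma(A^*)$ a $1$-cocycle. Then there is a unique Jacobi structure $(\Lambda_{(A^*,\phi)},E_{(A^*,\phi)})$ on the manifold $A^*$ whose Jacobi bracket satisfies $$\{\tilde\mu,\tilde\eta\}=\widetilde{[\![\mu,\eta]\!]},\qquad \{\tilde\mu,f\circ\pi^*\}=(\rho(\mu)(f)+\phi(\mu)f)\circ\pi^*,\qquad \{f\circ\pi^*,g\circ\pi^*\}=0$$ for all $\mu,\eta\in\Gamma(A)$ and $f,g\in C^\infty(M)$. It is given by $$\Lambda_{(A^*,\phi)}=\Lambda_{A^*}+\Delta\wedge\phi^v,\qquad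 E_{(A^*,\phi)}=-\phi^v.$$ Here $\Delta$ is the Liouville (Euler) vector field of $A^*$, $\phi^v$ is the vertical lift of $\phi$, and $\Lambda_{A^*}$ is the linear Poisson structure of the Lie algebroid: for local coordinates $(x^l)$ on $M$, a local basis of sections $(e_i)$ of $A$ with $[\![e_i,e_j]\!]=\sum_k c_{ij}^k e_k$, $\rho(e_i)=\sum_l\rho_i^l\,\partial/\partial x^l$, and the fibred coordinates $(x^l,\mu_j=\tilde e_j)$ on $A^*$, $$\Lambda_{A^*}=\sum_{i<j}\sum_k c_{ij}^k\mu_k\frac{\partial}{\partial\mu_i}\wedge\frac{\partial}{\partial\mu_j}+\sum_{i,l}\rho_i^l\frac{\partial}{\partial\mu_i}\wedge\frac{\partial}{\partial x^l}.$$ -/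

import Mathlib

open Bundle Manifold
open scoped ContDiff Topology

set_option maxSynthPendingDepth 3

noncomputable section

/-! ### Multivector fields and Jacobi structures on a manifold -/

section Jacobi

variable {E : Type*} [NormedAddCommGroup E] [NormedSpace ℝ E]
  {H : Type*} [TopologicalSpace H] (I : ModelWithCorners ℝ E H)
  {N : Type*} [TopologicalSpace N] [ChartedSpace H N]

/-- The cotangent space `T*_x N`. -/
abbrev Cotangent (x : N) : Type _ := TangentSpace I x →L[ℝ] ℝ

/-- Bilinear forms on the cotangent space `T*_x N`; the bivectors at `x`, i.e. the elements of
`⋀² T_x N`, are the alternating ones among them. -/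
abbrev CotangentForm (x : N) : Type _ := Cotangent I x →L[ℝ] Cotangent I x →L[ℝ] ℝ

/-- Evaluation of covectors at a tangent vector. -/
def evalVec {x : N} (X : TangentSpace I x) : Cotangent I x →L[ℝ] ℝ where
  toFun α := α X
  map_add' _ _ := rfl
  map_smul' _ _ := rfl
  cont := continuous_eval_const X

/-- The bivector `X ∧ Y` of two tangent vectors: `(X ∧ Y)(α, β) = α(X) β(Y) - α(Y) β(X)`. -/
def wedgeVec {x : N} (X Y : TangentSpace I x) : CotangentForm I x :=
  (evalVec I X).smulRight (evalVec I Y) - (evalVec I Y).smulRight (evalVec I X)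

/-- The trivector `X ∧ Λ` of a tangent vector and a bivector, as a function of three covectors:
`(X ∧ Λ)(α, β, γ) = α(X) Λ(β, γ) + β(X) Λ(γ, α) + γ(X) Λ(α, β)`. -/
def wedgeVecBivec {x : N} (X : TangentSpace I x) (Λ : CotangentForm I x)
    (α β γ : Cotangent I x) : ℝ :=
  α X * Λ β γ + β X * Λ γ α + γ X * Λ α β

/-- The function `Λ(df, dg)`. -/
def pairing (Λ : ∀ x : N, CotangentForm I x) (f g : N → ℝ) : N → ℝ :=
  fun x => Λ x (mvfderiv I f x) (mvfderiv I g x)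

/-- The derivative `X(f)` of a function along a vector field. -/
def along (X : ∀ x : N, TangentSpace I x) (f : N → ℝ) : N → ℝ :=
  fun x => mvfderiv I f x (X x)

/-- The Schouten-Nijenhuis bracket `[P, Q]` of two bivector fields, evaluated on `df, dg, dh`:
the sum over the cyclic permutations of `(f, g, h)` of
`P(d(Q(df, dg)), dh) + Q(d(P(df, dg)), dh)`. The sign is the one for which
`[X₁ ∧ X₂, Y₁ ∧ Y₂] = - ∑ i j, (-1)^(i+j) [X_i, Y_j] ∧ X_{3-i} ∧ Y_{3-j}`. -/
def schoutenBivec (P Q : ∀ x : N, CotangentForm I x) (f g h : N → ℝ) : N → ℝ :=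
  (pairing I P (pairing I Q f g) h + pairing I Q (pairing I P f g) h) +
  (pairing I P (pairing I Q g h) f + pairing I Q (pairing I P g h) f) +
  (pairing I P (pairing I Q h f) g + pairing I Q (pairing I P h f) g)

/-- The Schouten-Nijenhuis bracket `[X, Λ]` of a vector field and a bivector field, that is the
Lie derivative of `Λ` along `X`, evaluated on `df, dg`. -/
def schoutenVecBivec (X : ∀ x : N, TangentSpace I x) (Λ : ∀ x : N, CotangentForm I x)
    (f g : N → ℝ) : N → ℝ :=
  along I X (pairing I Λ f g) - pairing I Λ (along I X f) g - pairing I Λ f (along I X g)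

variable (N) in
/-- A Jacobi structure `(Λ, E)`: a smooth bivector field `Λ` and a smooth vector field `E` with
`[Λ, Λ] = 2 E ∧ Λ` and `[E, Λ] = 0`. The differentials of smooth functions span every cotangent
space, so the two identities between multivector fields are tested on them. -/
@[ext]
structure JacobiStructure [IsManifold I ∞ N] where
  /-- the bivector field -/
  bivec : ∀ x : N, CotangentForm I x
  /-- the vector field -/
  vec : ∀ x : N, TangentSpace I x
  bivec_self : ∀ (x : N) (α : Cotangent I x), bivec x α α = 0
  bivec_smooth : ContMDiff I (I.prod 𝓘(ℝ, (E →L[ℝ] ℝ) →L[ℝ] (E →L[ℝ] ℝ) →L[ℝ] ℝ)) ∞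
    (fun x => TotalSpace.mk' ((E →L[ℝ] ℝ) →L[ℝ] (E →L[ℝ] ℝ) →L[ℝ] ℝ)
      (E := fun x : N => CotangentForm I x) x (bivec x))
  vec_smooth : ContMDiff I I.tangent ∞ (fun x => (⟨x, vec x⟩ : TangentBundle I N))
  schouten_self : ∀ f g h : N → ℝ, ContMDiff I 𝓘(ℝ, ℝ) ∞ f → ContMDiff I 𝓘(ℝ, ℝ) ∞ g →
    ContMDiff I 𝓘(ℝ, ℝ) ∞ h → ∀ x : N,
      schoutenBivec I bivec bivec f g h x =
        2 * wedgeVecBivec I (vec x) (bivec x) (mvfderiv I f x) (mvfderiv I g x) (mvfderiv I h x)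
  schouten_vec : ∀ f g : N → ℝ, ContMDiff I 𝓘(ℝ, ℝ) ∞ f → ContMDiff I 𝓘(ℝ, ℝ) ∞ g →
    ∀ x : N, schoutenVecBivec I vec bivec f g x = 0

variable {I} in
/-- The Jacobi bracket `{f, g} = Λ(df, dg) + f E(g) - g E(f)`. -/
def JacobiStructure.bracket [IsManifold I ∞ N] (J : JacobiStructure I N) (f g : N → ℝ) : N → ℝ :=
  pairing I J.bivec f g + f * along I J.vec g - g * along I J.vec f

end Jacobi

/-! ### Lie algebroids -/

section Algebroid

variable {E : Type*} [NormedAddCommGroup E] [NormedSpace ℝ E]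
  {M : Type*} [TopologicalSpace M] [ChartedSpace E M]
  (F : Type*) [NormedAddCommGroup F] [NormedSpace ℝ F]
  (A : M → Type*) [∀ x, AddCommGroup (A x)] [∀ x, Module ℝ (A x)] [∀ x, TopologicalSpace (A x)]
  [TopologicalSpace (TotalSpace F A)] [FiberBundle F A] [VectorBundle ℝ F A]

variable (E) in
/-- The space `Γ(A)` of global smooth sections of `A`. -/
abbrev GlobalSections : Type _ := Cₛ^∞⟮𝓘(ℝ, E); F, A⟯

variable {F A} in
/-- The section `f μ`, for a smooth function `f` and a smooth section `μ`. -/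
def smulSection (f : C^∞⟮𝓘(ℝ, E), M; ℝ⟯) (μ : GlobalSections E F A) : GlobalSections E F A :=
  ⟨fun x => f x • μ x, f.contMDiff.smul_section μ.contMDiff⟩

variable (E) in
/-- A Lie algebroid structure on the vector bundle `A → M`: a real Lie algebra structure on `Γ(A)`
and a vector bundle map `ρ : A → TM` (the anchor) that is compatible with the Lie brackets and
satisfies the Leibniz rule. -/
structure LieAlgebroid [IsManifold 𝓘(ℝ, E) ∞ M] where
  /-- the Lie bracket on `Γ(A)` -/
  bracket : GlobalSections E F A →ₗ[ℝ] GlobalSections E F A →ₗ[ℝ] GlobalSections E F A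
  bracket_self : ∀ μ, bracket μ μ = 0
  jacobi : ∀ μ η ν,
    bracket μ (bracket η ν) + bracket η (bracket ν μ) + bracket ν (bracket μ η) = 0
  /-- the anchor map -/
  anchor : ∀ x : M, A x →ₗ[ℝ] TangentSpace 𝓘(ℝ, E) x
  anchor_smooth : ContMDiff (𝓘(ℝ, E).prod 𝓘(ℝ, F)) 𝓘(ℝ, E).tangent ∞
    (fun a : TotalSpace F A => (⟨a.1, anchor a.1 a.2⟩ : TangentBundle 𝓘(ℝ, E) M))
  anchor_bracket : ∀ (μ η : GlobalSections E F A) (x : M),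
    anchor x (bracket μ η x) = VectorField.mlieBracket 𝓘(ℝ, E)
      (fun y => anchor y (μ y)) (fun y => anchor y (η y)) x
  leibniz : ∀ (μ η : GlobalSections E F A) (f : C^∞⟮𝓘(ℝ, E), M; ℝ⟯) (x : M),
    bracket μ (smulSection f η) x =
      f x • bracket μ η x + mvfderiv 𝓘(ℝ, E) f x (anchor x (μ x)) • η x

/-! ### The dual bundle -/

/-- The fibre `A*_x` of the dual bundle. -/
abbrev DualFiber (x : M) : Type _ := A x →L[ℝ] ℝ

/-- The total space of the dual bundle `A* → M`, a manifold modelled on `E × F*`. -/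
abbrev DualBundle : Type _ := TotalSpace (F →L[ℝ] ℝ) (DualFiber A)

variable (E) in
/-- The model with corners of the total space of the dual bundle. -/
abbrev dualModel : ModelWithCorners ℝ (E × (F →L[ℝ] ℝ)) (ModelProd E (F →L[ℝ] ℝ)) :=
  𝓘(ℝ, E).prod 𝓘(ℝ, F →L[ℝ] ℝ)

variable (E) in
/-- The space `Γ(A*)` of global smooth sections of the dual bundle. -/
abbrev DualSections : Type _ := Cₛ^∞⟮𝓘(ℝ, E); F →L[ℝ] ℝ, DualFiber A⟯

variable {F A}

/-- `φ ∈ Γ(A*)` is a 1-cocycle: `φ[[μ, η]] = ρ(μ)(φ(η)) - ρ(η)(φ(μ))`. -/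
def LieAlgebroid.IsCocycle [IsManifold 𝓘(ℝ, E) ∞ M] (L : LieAlgebroid E F A)
    (φ : DualSections E F A) : Prop :=
  ∀ (μ η : GlobalSections E F A) (x : M),
    φ x (L.bracket μ η x) =
      mvfderiv 𝓘(ℝ, E) (fun y => φ y (η y)) x (L.anchor x (μ x)) -
        mvfderiv 𝓘(ℝ, E) (fun y => φ y (μ y)) x (L.anchor x (η x))

/-- The linear function `μ̃` on `A*` of a section `μ` of `A`. -/
def linearFunction (μ : GlobalSections E F A) : DualBundle F A → ℝ := fun p => p.2 (μ p.1)

variable (F A) in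
/-- The basic function `f ∘ π*` on `A*` of a function `f` on `M`. -/
def basicFunction (f : M → ℝ) : DualBundle F A → ℝ := fun p => f p.1

variable (E) in
/-- The vertical lift of `θ ∈ A*_x` to the point `p ∈ A*_x`: the velocity at `t = 0` of the curve
`t ↦ p + t θ`. -/
def verticalVec (p : DualBundle F A) (θ : DualFiber A p.1) : TangentSpace (dualModel E F) p :=
  mfderiv 𝓘(ℝ, ℝ) (dualModel E F)
    (fun t : ℝ => (⟨p.1, p.2 + t • θ⟩ : DualBundle F A)) 0 (1 : ℝ)

/-- The Liouville vector field `Δ` of `A*`. -/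
def liouville (p : DualBundle F A) : TangentSpace (dualModel E F) p := verticalVec E p p.2

/-- The vertical lift `φ^v` of a section `φ` of `A*`, a vector field on `A*`. -/
def verticalLift (φ : DualSections E F A) (p : DualBundle F A) : TangentSpace (dualModel E F) p :=
  verticalVec E p (φ p.1)

/-! ### The linear Poisson structure on the dual bundle of a Lie algebroid -/

section LinearPoisson

variable [FiniteDimensional ℝ E] [T2Space M] [IsManifold 𝓘(ℝ, E) ∞ M]
  [ContMDiffVectorBundle ∞ F A 𝓘(ℝ, E)]

variable (E A) in
/-- Every vector `u` of the model fibre is, near `x`, the constant value of a global smooth section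
of `A` in the trivialization around `x`. -/
theorem exists_frameSection (x : M) (u : F) :
    ∃ s : GlobalSections E F A, ∀ᶠ y in 𝓝 x, s y = (trivializationAt F A x).symm y u := by
  set t := trivializationAt F A x
  have ht : t.baseSet ∈ 𝓝 x := t.open_baseSet.mem_nhds (FiberBundle.mem_baseSet_trivializationAt' x)
  obtain ⟨b, -, hb⟩ := (SmoothBumpFunction.nhds_basis_tsupport (I := 𝓘(ℝ, E)) x).mem_iff.1 ht
  have hs : ContMDiffOn 𝓘(ℝ, E) (𝓘(ℝ, E).prod 𝓘(ℝ, F)) ∞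
      (fun y => TotalSpace.mk' F y (t.symm y u)) t.baseSet := by
    intro y hy
    rw [t.contMDiffWithinAt_section _ hy]
    exact (contMDiffWithinAt_const (c := u)).congr (fun z hz => by simp [hz]) (by simp [hy])
  refine ⟨⟨_, b.contMDiff.contMDiffOn.smul_section_of_tsupport t.open_baseSet hb hs⟩, ?_⟩
  filter_upwards [b.eventuallyEq_one] with y hy
  have hy' : b y = 1 := hy
  simp [hy']

variable (E A) in
/-- A global smooth section of `A` that near `x` has the constant value `u` in the trivialization
around `x`. For `u` running through a basis of the model fibre, these sections form a local basis
of sections of `A` near `x`. -/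
def frameSection (x : M) (u : F) : GlobalSections E F A := (exists_frameSection E A x u).choose

variable (A) in
/-- The elements `e^i` at `x` of the basis dual to the local basis
`e_i = frameSection x (Module.finBasis ℝ F i)`. -/
def dualFrame [FiniteDimensional ℝ F] (x : M) (i : Fin (Module.finrank ℝ F)) : DualFiber A x :=
  ((Module.finBasis ℝ F).coord i).toContinuousLinearMap ∘L
    (trivializationAt F A x).continuousLinearMapAt ℝ x

/-- For a tangent vector `v = ∑ v^l ∂/∂x^l` of `M` at `x = π*(p)`, the vector `∑ v^l ∂/∂x^l` of `A*`
at `p`, in the fibred coordinates `(x^l, μ_j)` of the local basis around `x`: the derivative along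
`v` of the local section of `A*` through `p` on which all the `μ_j` are constant. -/
def coordVec (p : DualBundle F A) (v : TangentSpace 𝓘(ℝ, E) p.1) :
    TangentSpace (dualModel E F) p :=
  mfderiv 𝓘(ℝ, E) (dualModel E F)
    (fun y : M => (⟨y, FiberBundle.extend (F →L[ℝ] ℝ) p.2 y⟩ : DualBundle F A)) p.1 v

/-- The linear Poisson bivector `Λ_{A*}` of a Lie algebroid: in the fibred coordinates `(x^l, μ_j)`
given by a local basis of sections `e_i` with `[[e_i, e_j]] = ∑ k, c_ij^k e_k` and
`ρ(e_i) = ∑ l, ρ_i^l ∂/∂x^l`, it is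
`∑_{i<j} ∑_k c_ij^k μ_k ∂/∂μ_i ∧ ∂/∂μ_j + ∑_{i,l} ρ_i^l ∂/∂μ_i ∧ ∂/∂x^l`.
At `p` the number `∑_k c_ij^k μ_k` is `p([[e_i, e_j]])`, and `∂/∂μ_i` is the vertical lift of
`e^i`. -/
def LieAlgebroid.linearPoisson [FiniteDimensional ℝ F] (L : LieAlgebroid E F A)
    (p : DualBundle F A) : CotangentForm (dualModel E F) p :=
  let e (i : Fin (Module.finrank ℝ F)) : GlobalSections E F A :=
    frameSection E A p.1 (Module.finBasis ℝ F i)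
  let dμ (i : Fin (Module.finrank ℝ F)) : TangentSpace (dualModel E F) p :=
    verticalVec E p (dualFrame A p.1 i)
  ∑ i, ∑ j ∈ Finset.Ioi i,
      p.2 (L.bracket (e i) (e j) p.1) • wedgeVec (dualModel E F) (dμ i) (dμ j) +
    ∑ i, wedgeVec (dualModel E F) (dμ i) (coordVec p (L.anchor p.1 (e i p.1)))

/-- The bracket of a Jacobi structure on `A*` satisfies
`{μ̃, η̃} = [[μ, η]]~`, `{μ̃, f ∘ π*} = (ρ(μ)(f) + φ(μ) f) ∘ π*` and `{f ∘ π*, g ∘ π*} = 0`. -/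
structure LieAlgebroid.IsInducedBy (L : LieAlgebroid E F A) (φ : DualSections E F A)
    (J : JacobiStructure (dualModel E F) (DualBundle F A)) : Prop where
  linear_linear : ∀ μ η : GlobalSections E F A,
    J.bracket (linearFunction μ) (linearFunction η) = linearFunction (L.bracket μ η)
  linear_basic : ∀ (μ : GlobalSections E F A) (f : C^∞⟮𝓘(ℝ, E), M; ℝ⟯),
    J.bracket (linearFunction μ) (basicFunction F A f) =
      basicFunction F A
        (fun x => mvfderiv 𝓘(ℝ, E) f x (L.anchor x (μ x)) + φ x (μ x) * f x)
  basic_basic : ∀ f g : C^∞⟮𝓘(ℝ, E), M; ℝ⟯,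
    J.bracket (basicFunction F A f) (basicFunction F A g) = 0

end LinearPoisson

end Algebroid

end

/-
Consider the functions `μ̃ + f ∘ π*` on `A*` that are affine on the fibres, for `(μ, f)` in
`Γ(A) × C^∞(M)`. The prescribed bracket of two of them is the semidirect product bracket
`(⟦μ, η⟧, D_μ g - D_η f)`, where `D_μ f = ρ(μ)(f) + φ(μ) f`; the cocycle condition says that `D`
is a representation of `Γ(A)`, so this bracket satisfies the Jacobi identity.

For any pair `(Λ, X)`, the Jacobiator of `{f, g} = Λ(df, dg) + f X(g) - g X(f)` on `f, g, h` is
`½ [Λ, Λ] - X ∧ Λ` on `(df, dg, dh)`, minus the cyclic sum of `f [X, Λ](dg, dh)`. The affine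
functions contain `1`, with `{1, g} = X(g)`, and their differentials exhaust the cotangent spaces.
Hence the Jacobi identity on affine functions gives `[X, Λ] = 0` (put `h = 1`) and then
`[Λ, Λ] = 2 X ∧ Λ`, and the bracket of affine functions determines `(Λ, X)`.
-/

noncomputable section

section FiniteDimensional

variable {E : Type*} [NormedAddCommGroup E] [NormedSpace ℝ E]
  {H : Type*} [TopologicalSpace H] {I : ModelWithCorners ℝ E H}
  {N : Type*} [TopologicalSpace N] [ChartedSpace H N]
  {V : Type*} [NormedAddCommGroup V] [NormedSpace ℝ V] [FiniteDimensional ℝ V]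
  {W : Type*} [NormedAddCommGroup W] [NormedSpace ℝ W]
  {n : WithTop ℕ∞} {x : N}

theorem contMDiffAt_of_forall_clm {u : N → V}
    (h : ∀ α : V →L[ℝ] ℝ, ContMDiffAt I 𝓘(ℝ, ℝ) n (fun y => α (u y)) x) :
    ContMDiffAt I 𝓘(ℝ, V) n u x := by
  let e := (Module.finBasis ℝ V).equivFunL
  have he : ContMDiffAt I 𝓘(ℝ, Fin (Module.finrank ℝ V) → ℝ) n (fun y => e (u y)) x :=
    contMDiffAt_pi_space.2 fun i =>
      h ((ContinuousLinearMap.proj (R := ℝ) (φ := fun _ => ℝ) i).comp e.toContinuousLinearMap)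
  simpa [Function.comp_def] using e.symm.contDiff.contMDiff.contMDiffAt.comp x he

theorem contMDiffAt_of_forall_clm_apply {u : N → V →L[ℝ] W}
    (h : ∀ v, ContMDiffAt I 𝓘(ℝ, W) n (fun y => u y v) x) :
    ContMDiffAt I 𝓘(ℝ, V →L[ℝ] W) n u x := by
  let e := ((Module.finBasis ℝ V).equivFunL.arrowCongr (.refl ℝ W)).trans
    (ContinuousLinearEquiv.piRing (Fin (Module.finrank ℝ V)))
  have he : ContMDiffAt I 𝓘(ℝ, Fin (Module.finrank ℝ V) → W) n (fun y => e (u y)) x :=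
    contMDiffAt_pi_space.2 fun i => h _
  simpa [Function.comp_def] using e.symm.contDiff.contMDiff.contMDiffAt.comp x he

theorem exists_forall_clm_apply_eq (Φ : (V →L[ℝ] ℝ) →ₗ[ℝ] ℝ) :
    ∃ v : V, ∀ α : V →L[ℝ] ℝ, α v = Φ α :=
  let Ψ := Φ ∘ₗ (LinearMap.toContinuousLinearMap (𝕜 := ℝ) (E := V) (F' := ℝ)).toLinearMap
  ⟨(Module.evalEquiv ℝ V).symm Ψ, fun α =>
    Module.apply_evalEquiv_symm_apply (R := ℝ) (M := V) α.toLinearMap Ψ⟩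

end FiniteDimensional

section Differential

variable {E : Type*} [NormedAddCommGroup E] [NormedSpace ℝ E]
  {H : Type*} [TopologicalSpace H] {I : ModelWithCorners ℝ E H}
  {N : Type*} [TopologicalSpace N] [ChartedSpace H N]

theorem mvfderiv_congr_of_eventuallyEq {V : Type*} [NormedAddCommGroup V] [NormedSpace ℝ V]
    {f g : N → V} {x : N} (h : f =ᶠ[𝓝 x] g) :
    mvfderiv I f x = mvfderiv I g x :=
  congrArg (fun L : E →L[ℝ] V => L) h.mfderiv_eq

theorem mvfderiv_clm_comp {V : Type*} [NormedAddCommGroup V] [NormedSpace ℝ V]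
    (α : V →L[ℝ] ℝ) {g : N → V} {x : N} (hg : MDifferentiableAt I 𝓘(ℝ, V) g x) :
    mvfderiv I (fun y => α (g y)) x = α ∘L mvfderiv I g x := by
  have hα : mvfderiv 𝓘(ℝ, V) α (g x) = α := by
    ext v
    simp only [mvfderiv, mfderiv_eq_fderiv, ContinuousLinearMap.fderiv]
    rfl
  have := mvfderiv_comp (I := 𝓘(ℝ, V)) (I' := I) (g := (α : V → ℝ)) x
    α.differentiableAt.mdifferentiableAt hg
  refine this.trans ?_
  rw [hα]
  rfl

variable [IsManifold I ∞ N]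

theorem contMDiffAt_cotangent_mvfderiv {f : N → ℝ} {x : N} (hf : ContMDiffAt I 𝓘(ℝ, ℝ) ∞ f x) :
    ContMDiffAt I (I.prod 𝓘(ℝ, E →L[ℝ] ℝ)) ∞
      (fun y => TotalSpace.mk' (E →L[ℝ] ℝ) (E := fun y : N => Cotangent I y) y (mvfderiv I f y))
      x := by
  rw [contMDiffAt_hom_bundle]
  refine ⟨contMDiffAt_id, (hf.mfderiv_const (m := ∞) (by simp)).congr_of_eventuallyEq ?_⟩
  refine .of_forall fun y => ?_
  ext v
  simp only [mvfderiv, inTangentCoordinates, ContinuousLinearMap.inCoordinates,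
    Trivial.fiberBundle_trivializationAt', Trivial.continuousLinearMapAt_trivialization,
    ContinuousLinearMap.id_comp, ContinuousLinearMap.comp_apply, ContinuousLinearEquiv.coe_coe,
    TangentBundle.continuousLinearMapAt_model_space, id_eq]
  rfl

theorem contMDiff_along {X : ∀ x : N, TangentSpace I x} {f : N → ℝ}
    (hX : ContMDiff I I.tangent ∞ (fun x => (⟨x, X x⟩ : TangentBundle I N)))
    (hf : ContMDiff I 𝓘(ℝ, ℝ) ∞ f) : ContMDiff I 𝓘(ℝ, ℝ) ∞ (along I X f) := fun x =>
  (contMDiffAt_section x).1 <| ContMDiffAt.clm_bundle_apply (F₂ := ℝ) (E₂ := Trivial N ℝ)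
    (contMDiffAt_cotangent_mvfderiv (hf x)) (hX x)

variable (I) in
/-- Smoothness at `x` of a field of bilinear forms on the cotangent spaces, as a section of the
bundle of these forms. -/
abbrev SmoothBivecAt (Λ : ∀ x : N, CotangentForm I x) (x : N) : Prop :=
  ContMDiffAt I (I.prod 𝓘(ℝ, (E →L[ℝ] ℝ) →L[ℝ] (E →L[ℝ] ℝ) →L[ℝ] ℝ)) ∞
    (fun x => TotalSpace.mk' ((E →L[ℝ] ℝ) →L[ℝ] (E →L[ℝ] ℝ) →L[ℝ] ℝ)
      (E := fun x : N => CotangentForm I x) x (Λ x)) x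

theorem contMDiffAt_pairing {Λ : ∀ x : N, CotangentForm I x} {f g : N → ℝ} {x : N}
    (hΛ : SmoothBivecAt I Λ x) (hf : ContMDiffAt I 𝓘(ℝ, ℝ) ∞ f x)
    (hg : ContMDiffAt I 𝓘(ℝ, ℝ) ∞ g x) :
    ContMDiffAt I 𝓘(ℝ, ℝ) ∞ (pairing I Λ f g) x :=
  (contMDiffAt_section x).1 <| ContMDiffAt.clm_bundle_apply₂ (F₃ := ℝ) (E₃ := Trivial N ℝ)
    hΛ (contMDiffAt_cotangent_mvfderiv hf) (contMDiffAt_cotangent_mvfderiv hg)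

theorem mvfderiv_clm_extChartAt (α : E →L[ℝ] ℝ) {x₀ x : N} (hx : x ∈ (chartAt H x₀).source) :
    mvfderiv I (fun y => α (extChartAt I x₀ y)) x =
      α ∘L (trivializationAt E (TangentSpace I) x₀).continuousLinearMapAt ℝ x := by
  rw [mvfderiv_clm_comp _ (mdifferentiableAt_extChartAt hx),
    TangentBundle.continuousLinearMapAt_trivializationAt hx]
  rfl

theorem contMDiffAt_vectorField_of_coord [FiniteDimensional ℝ E]
    {X : ∀ x : N, TangentSpace I x} {x₀ : N}
    (h : ∀ α : E →L[ℝ] ℝ, ContMDiffAt I 𝓘(ℝ, ℝ) ∞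
      (along I X (fun y => α (extChartAt I x₀ y))) x₀) :
    ContMDiffAt I I.tangent ∞ (fun x => (⟨x, X x⟩ : TangentBundle I N)) x₀ := by
  refine (contMDiffAt_section x₀).2 (contMDiffAt_of_forall_clm fun α => ?_)
  refine (h α).congr_of_eventuallyEq ?_
  filter_upwards [(chartAt H x₀).open_source.mem_nhds (mem_chart_source H x₀)] with x hx
  have hx' : x ∈ (trivializationAt E (TangentSpace I) x₀).baseSet := by simpa using hx
  rw [along, mvfderiv_clm_extChartAt α hx, ContinuousLinearMap.comp_apply,
    Trivialization.continuousLinearMapAt_apply, Trivialization.coe_linearMapAt_of_mem _ hx']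

end Differential

section DualTrivialization

variable {M : Type*} [TopologicalSpace M]
  {F : Type*} [NormedAddCommGroup F] [NormedSpace ℝ F]
  {A : M → Type*} [∀ x, AddCommGroup (A x)] [∀ x, Module ℝ (A x)] [∀ x, TopologicalSpace (A x)]
  [TopologicalSpace (TotalSpace F A)] [FiberBundle F A] [VectorBundle ℝ F A]

theorem mem_baseSet_dual_trivializationAt {x₀ x : M} (hx : x ∈ (trivializationAt F A x₀).baseSet) :
    x ∈ (trivializationAt (F →L[ℝ] ℝ) (fun x => A x →L[ℝ] ℝ) x₀).baseSet := by
  rw [hom_trivializationAt_baseSet]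
  exact ⟨hx, Set.mem_univ x⟩

theorem dual_trivializationAt_snd {x₀ x : M} (θ : A x →L[ℝ] ℝ) :
    (trivializationAt (F →L[ℝ] ℝ) (fun x => A x →L[ℝ] ℝ) x₀ ⟨x, θ⟩).2 =
      θ ∘L (trivializationAt F A x₀).symmL ℝ x := by
  rw [hom_trivializationAt_apply]
  ext u
  simp [ContinuousLinearMap.inCoordinates]

theorem dual_continuousLinearMapAt {x₀ x : M} (hx : x ∈ (trivializationAt F A x₀).baseSet)
    (θ : A x →L[ℝ] ℝ) :
    (trivializationAt (F →L[ℝ] ℝ) (fun x => A x →L[ℝ] ℝ) x₀).continuousLinearMapAt ℝ x θ =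
      θ ∘L (trivializationAt F A x₀).symmL ℝ x := by
  rw [Trivialization.continuousLinearMapAt_apply,
    Trivialization.coe_linearMapAt_of_mem _ (mem_baseSet_dual_trivializationAt hx)]
  exact dual_trivializationAt_snd θ

theorem dual_symmL {x₀ x : M} (hx : x ∈ (trivializationAt F A x₀).baseSet)
    (w : F →L[ℝ] ℝ) :
    (trivializationAt (F →L[ℝ] ℝ) (fun x => A x →L[ℝ] ℝ) x₀).symmL ℝ x w =
      w ∘L (trivializationAt F A x₀).continuousLinearMapAt ℝ x := by
  have h : w = (trivializationAt (F →L[ℝ] ℝ) (fun x => A x →L[ℝ] ℝ) x₀).continuousLinearMapAt ℝ x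
      (w ∘L (trivializationAt F A x₀).continuousLinearMapAt ℝ x) := by
    rw [dual_continuousLinearMapAt hx]
    ext u
    simp [Trivialization.continuousLinearMapAt_symmL _ hx]
  conv_lhs => rw [h]
  exact Trivialization.symmL_continuousLinearMapAt _ (mem_baseSet_dual_trivializationAt hx) _

end DualTrivialization

section Bivector

variable {E : Type*} [NormedAddCommGroup E] [NormedSpace ℝ E] [FiniteDimensional ℝ E]
  {H : Type*} [TopologicalSpace H] {I : ModelWithCorners ℝ E H}
  {N : Type*} [TopologicalSpace N] [ChartedSpace H N]

theorem exists_sharp {x : N} (Λ : CotangentForm I x) (β : Cotangent I x) :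
    ∃ v : TangentSpace I x, ∀ α : Cotangent I x, α v = Λ α β :=
  exists_forall_clm_apply_eq (V := E)
    { toFun := fun α => Λ α β
      map_add' := fun a b => congrArg (· β) (Λ.map_add a b)
      map_smul' := fun c a => congrArg (· β) (Λ.map_smul c a) }

/-- The contraction of a bivector with a covector in its second slot; `sharp Λ (dg)` is the
Hamiltonian vector field of `g`. -/
def sharp {x : N} (Λ : CotangentForm I x) (β : Cotangent I x) : TangentSpace I x :=
  (exists_sharp Λ β).choose

@[simp]
theorem apply_sharp {x : N} (Λ : CotangentForm I x) (α β : Cotangent I x) :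
    α (sharp Λ β) = Λ α β :=
  (exists_sharp Λ β).choose_spec α

theorem along_sharp (Λ : ∀ x : N, CotangentForm I x) (f g : N → ℝ) :
    along I (fun x => sharp (Λ x) (mvfderiv I g x)) f = pairing I Λ f g :=
  funext fun _ => apply_sharp _ _ _

variable [IsManifold I ∞ N]

theorem contMDiff_sharp {Λ : ∀ x : N, CotangentForm I x} {g : N → ℝ}
    (hΛ : ∀ x, SmoothBivecAt I Λ x) (hg : ContMDiff I 𝓘(ℝ, ℝ) ∞ g) :
    ContMDiff I I.tangent ∞
      (fun x => (⟨x, sharp (Λ x) (mvfderiv I g x)⟩ : TangentBundle I N)) := fun x =>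
  contMDiffAt_vectorField_of_coord fun α => by
    rw [along_sharp]
    exact contMDiffAt_pairing (hΛ x)
      (α.contDiff.contMDiff.contMDiffAt.comp x contMDiffAt_extChartAt) (hg x)

theorem contMDiffAt_bivec_of_coord {Λ : ∀ x : N, CotangentForm I x} {x₀ : N}
    (h : ∀ α β : E →L[ℝ] ℝ, ContMDiffAt I 𝓘(ℝ, ℝ) ∞
      (pairing I Λ (fun y => α (extChartAt I x₀ y)) (fun y => β (extChartAt I x₀ y))) x₀) :
    SmoothBivecAt I Λ x₀ := by
  refine (contMDiffAt_hom_bundle _).2 ⟨contMDiffAt_id,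
    contMDiffAt_of_forall_clm_apply fun α => contMDiffAt_of_forall_clm_apply fun β =>
      (h α β).congr_of_eventuallyEq ?_⟩
  filter_upwards [(chartAt H x₀).open_source.mem_nhds (mem_chart_source H x₀)] with x hx
  have hx' : x ∈ (trivializationAt E (TangentSpace I) x₀).baseSet := by simpa using hx
  rw [pairing, mvfderiv_clm_extChartAt α hx, mvfderiv_clm_extChartAt β hx, ← dual_symmL hx',
    ← dual_symmL hx', ContinuousLinearMap.inCoordinates, ContinuousLinearMap.comp_apply,
    ContinuousLinearMap.comp_apply,
    dual_continuousLinearMapAt (mem_baseSet_dual_trivializationAt hx')]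
  rfl

end Bivector

section Commutator

open VectorField

variable {E : Type*} [NormedAddCommGroup E] [NormedSpace ℝ E]

theorem fderiv_fderiv_apply_sub_fderiv_fderiv_apply {f : E → ℝ} {X Y : E → E} {x : E}
    (hf : ContDiffAt ℝ 2 f x) (hX : DifferentiableAt ℝ X x) (hY : DifferentiableAt ℝ Y x) :
    fderiv ℝ (fun y => fderiv ℝ f y (Y y)) x (X x) -
        fderiv ℝ (fun y => fderiv ℝ f y (X y)) x (Y x) =
      fderiv ℝ f x (lieBracket ℝ X Y x) := by
  have hdf : DifferentiableAt ℝ (fderiv ℝ f) x :=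
    (hf.fderiv_right (m := 1) (by norm_num)).differentiableAt (by simp)
  rw [fderiv_clm_apply hdf hX, fderiv_clm_apply hdf hY, lieBracket_eq, map_sub]
  simp only [add_apply, ContinuousLinearMap.comp_apply,
    ContinuousLinearMap.flip_apply, (hf.isSymmSndFDerivAt (by simp)).eq (X x) (Y x)]
  ring

variable {H : Type*} [TopologicalSpace H] {I : ModelWithCorners ℝ E H} [I.Boundaryless]
  {N : Type*} [TopologicalSpace N] [ChartedSpace H N]

theorem mfderiv_extChartAt_symm_isInvertible [IsManifold I 1 N] {x : N} {y : E}
    (hy : y ∈ (extChartAt I x).target) :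
    (mfderiv 𝓘(ℝ, E) I (extChartAt I x).symm y).IsInvertible := by
  simpa only [I.range_eq_univ, mfderivWithin_univ] using
    isInvertible_mfderivWithin_extChartAt_symm (I := I) hy

theorem along_extChartAt_symm [IsManifold I 1 N] {f : N → ℝ} (Z : ∀ x : N, TangentSpace I x)
    {x : N} {y : E} (hy : y ∈ (extChartAt I x).target)
    (hf : MDifferentiableAt I 𝓘(ℝ, ℝ) f ((extChartAt I x).symm y)) :
    along I Z f ((extChartAt I x).symm y) =
      fderiv ℝ (f ∘ (extChartAt I x).symm) y (mpullback 𝓘(ℝ, E) I (extChartAt I x).symm Z y) := by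
  have hφ : MDifferentiableAt 𝓘(ℝ, E) I (extChartAt I x).symm y := by
    simpa only [I.range_eq_univ, mdifferentiableWithinAt_univ] using
      mdifferentiableWithinAt_extChartAt_symm (I := I) hy
  have hc := mvfderiv_comp_apply (I' := 𝓘(ℝ, E)) (I := I) y hf hφ
    (mpullback 𝓘(ℝ, E) I (extChartAt I x).symm Z y)
  rw [mpullback_apply, (mfderiv_extChartAt_symm_isInvertible hy).self_apply_inverse] at hc
  rw [mpullback_apply]
  refine hc.symm.trans ?_
  simp only [mvfderiv, mfderiv_eq_fderiv]
  rfl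

theorem contMDiffAt_extChartAt_symm_self {n : WithTop ℕ∞} [IsManifold I n N] (x : N) :
    ContMDiffAt 𝓘(ℝ, E) I n (extChartAt I x).symm (extChartAt I x x) := by
  simpa only [I.range_eq_univ, contMDiffWithinAt_univ] using
    contMDiffWithinAt_extChartAt_symm_range (I := I) (n := n) x (mem_extChartAt_target x)

variable [CompleteSpace E]

theorem differentiableAt_mpullback_extChartAt_symm [IsManifold I 2 N]
    {Z : ∀ x : N, TangentSpace I x} {x : N}
    (hZ : MDifferentiableAt I I.tangent (fun x => (⟨x, Z x⟩ : TangentBundle I N)) x) :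
    DifferentiableAt ℝ (mpullback 𝓘(ℝ, E) I (extChartAt I x).symm Z) (extChartAt I x x) := by
  have h := (hZ.mdifferentiableWithinAt
    (s := Set.univ)).differentiableWithinAt_mpullbackWithin_vectorField
  simp only [I.range_eq_univ, Set.preimage_univ, Set.univ_inter, mpullbackWithin_univ] at h
  exact differentiableWithinAt_univ.1 h

theorem mpullback_extChartAt_symm_mlieBracket [IsManifold I 2 N]
    {X Y : ∀ x : N, TangentSpace I x} {x : N}
    (hX : MDifferentiableAt I I.tangent (fun x => (⟨x, X x⟩ : TangentBundle I N)) x)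
    (hY : MDifferentiableAt I I.tangent (fun x => (⟨x, Y x⟩ : TangentBundle I N)) x) :
    mpullback 𝓘(ℝ, E) I (extChartAt I x).symm (mlieBracket I X Y) (extChartAt I x x) =
      lieBracket ℝ (mpullback 𝓘(ℝ, E) I (extChartAt I x).symm X)
        (mpullback 𝓘(ℝ, E) I (extChartAt I x).symm Y) (extChartAt I x x) := by
  have : IsManifold I (minSmoothness ℝ 2) N := by simpa
  have hx : (extChartAt I x).symm (extChartAt I x x) = x := extChartAt_to_inv x
  rw [mpullback_mlieBracket (hx.symm ▸ hX) (hx.symm ▸ hY)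
    (contMDiffAt_extChartAt_symm_self (n := 2) x) (by simp), ← mlieBracketWithin_univ,
    mlieBracketWithin_eq_lieBracketWithin]
  exact congrFun (lieBracketWithin_univ (𝕜 := ℝ) (E := E)) _

theorem mvfderiv_mlieBracket [IsManifold I ∞ N] {X Y : ∀ x : N, TangentSpace I x} {f : N → ℝ}
    (hX : ContMDiff I I.tangent ∞ (fun x => (⟨x, X x⟩ : TangentBundle I N)))
    (hY : ContMDiff I I.tangent ∞ (fun x => (⟨x, Y x⟩ : TangentBundle I N)))
    (hf : ContMDiff I 𝓘(ℝ, ℝ) ∞ f) (x : N) :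
    mvfderiv I f x (mlieBracket I X Y x) =
      along I X (along I Y f) x - along I Y (along I X f) x := by
  have hx : (extChartAt I x).symm (extChartAt I x x) = x := extChartAt_to_inv x
  have hchart : ∀ Z g, ContMDiff I 𝓘(ℝ, ℝ) ∞ g → along I Z g x =
      fderiv ℝ (g ∘ (extChartAt I x).symm) (extChartAt I x x)
        (mpullback 𝓘(ℝ, E) I (extChartAt I x).symm Z (extChartAt I x x)) := fun Z g hg => by
    rw [← along_extChartAt_symm Z (mem_extChartAt_target x) ((hg _).mdifferentiableAt (by simp)),
      hx]
  have hnear : ∀ Z, along I Z f ∘ (extChartAt I x).symm =ᶠ[𝓝 (extChartAt I x x)] fun y =>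
      fderiv ℝ (f ∘ (extChartAt I x).symm) y
        (mpullback 𝓘(ℝ, E) I (extChartAt I x).symm Z y) := fun Z => by
    filter_upwards [extChartAt_target_mem_nhds (I := I) x] with y hy
    exact along_extChartAt_symm Z hy ((hf _).mdifferentiableAt (by simp))
  have hf' : ContDiffAt ℝ 2 (f ∘ (extChartAt I x).symm) (extChartAt I x x) :=
    contMDiffAt_iff_contDiffAt.1
      (((hf _).of_le (WithTop.coe_le_coe.2 (le_top : (2 : ℕ∞) ≤ ⊤))).comp _
        (contMDiffAt_extChartAt_symm_self x))
  have hX' := (hX x).mdifferentiableAt (by simp)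
  have hY' := (hY x).mdifferentiableAt (by simp)
  rw [hchart X _ (contMDiff_along hY hf), hchart Y _ (contMDiff_along hX hf), (hnear X).fderiv_eq,
    (hnear Y).fderiv_eq,
    fderiv_fderiv_apply_sub_fderiv_fderiv_apply hf' (differentiableAt_mpullback_extChartAt_symm hX')
      (differentiableAt_mpullback_extChartAt_symm hY'),
    ← mpullback_extChartAt_symm_mlieBracket hX' hY']
  exact hchart (mlieBracket I X Y) f hf

end Commutator

section Schouten

variable {E : Type*} [NormedAddCommGroup E] [NormedSpace ℝ E]
  {H : Type*} [TopologicalSpace H] {I : ModelWithCorners ℝ E H}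
  {N : Type*} [TopologicalSpace N] [ChartedSpace H N]
  {Λ : ∀ x : N, CotangentForm I x} {X : ∀ x : N, TangentSpace I x}

theorem bivec_swap {x : N} {P : CotangentForm I x} (hP : ∀ α, P α α = 0) (α β : Cotangent I x) :
    P α β = -P β α := by
  have h := hP (α + β)
  simp only [map_add, add_apply, hP, zero_add, add_zero] at h
  linarith

theorem pairing_swap (hΛ : ∀ x α, Λ x α α = 0) (f g : N → ℝ) :
    pairing I Λ f g = -pairing I Λ g f :=
  funext fun x => bivec_swap (hΛ x) _ _

theorem schoutenVecBivec_swap (hΛ : ∀ x α, Λ x α α = 0) (f g : N → ℝ) (x : N) :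
    schoutenVecBivec I X Λ f g x = -schoutenVecBivec I X Λ g f x := by
  rw [schoutenVecBivec, pairing_swap hΛ f g, pairing_swap hΛ _ g, pairing_swap hΛ f]
  simp only [schoutenVecBivec, along, Pi.sub_apply, Pi.neg_apply, mvfderiv_neg, neg_apply]
  ring

theorem schoutenBivec_rotate (P Q : ∀ x : N, CotangentForm I x) (f g h : N → ℝ) (x : N) :
    schoutenBivec I P Q f g h x = schoutenBivec I P Q g h f x := by
  simp only [schoutenBivec, Pi.add_apply]
  ring

variable [FiniteDimensional ℝ E] [I.Boundaryless] [IsManifold I ∞ N]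

open VectorField

-- The right-hand side involves `f` only through its differential at `x`: the bracket, a priori a
-- second-order expression in `f`, is tensorial.
theorem schoutenVecBivec_eq
    (hX : ContMDiff I I.tangent ∞ (fun x => (⟨x, X x⟩ : TangentBundle I N)))
    (hΛ : ∀ x, SmoothBivecAt I Λ x) {f g : N → ℝ}
    (hf : ContMDiff I 𝓘(ℝ, ℝ) ∞ f) (hg : ContMDiff I 𝓘(ℝ, ℝ) ∞ g) (x : N) :
    schoutenVecBivec I X Λ f g x =
      mvfderiv I f x (mlieBracket I X (fun y => sharp (Λ y) (mvfderiv I g y)) x) -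
        Λ x (mvfderiv I f x) (mvfderiv I (along I X g) x) := by
  have hcomm := mvfderiv_mlieBracket hX (contMDiff_sharp hΛ hg) hf x
  rw [along_sharp, along_sharp] at hcomm
  rw [hcomm]
  rfl

theorem schoutenBivec_self_eq (hΛ : ∀ x, SmoothBivecAt I Λ x) (hΛ₀ : ∀ x α, Λ x α α = 0)
    {f g h : N → ℝ} (hf : ContMDiff I 𝓘(ℝ, ℝ) ∞ f) (hg : ContMDiff I 𝓘(ℝ, ℝ) ∞ g)
    (hh : ContMDiff I 𝓘(ℝ, ℝ) ∞ h) (x : N) :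
    schoutenBivec I Λ Λ f g h x = 2 *
      (mvfderiv I f x (mlieBracket I (fun y => sharp (Λ y) (mvfderiv I h y))
          (fun y => sharp (Λ y) (mvfderiv I g y)) x) -
        Λ x (mvfderiv I f x) (mvfderiv I (pairing I Λ g h) x)) := by
  have hcomm := mvfderiv_mlieBracket (contMDiff_sharp hΛ hh) (contMDiff_sharp hΛ hg) hf x
  simp only [along_sharp] at hcomm
  rw [hcomm, bivec_swap (hΛ₀ x)]
  simp only [schoutenBivec, Pi.add_apply, pairing_swap hΛ₀ h f]
  simp only [pairing, mvfderiv_neg, map_neg, neg_apply]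
  ring

theorem schoutenVecBivec_congr
    (hX : ContMDiff I I.tangent ∞ (fun x => (⟨x, X x⟩ : TangentBundle I N)))
    (hΛ : ∀ x, SmoothBivecAt I Λ x) (hΛ₀ : ∀ x α, Λ x α α = 0) {f f' g g' : N → ℝ}
    (hf : ContMDiff I 𝓘(ℝ, ℝ) ∞ f) (hf' : ContMDiff I 𝓘(ℝ, ℝ) ∞ f')
    (hg : ContMDiff I 𝓘(ℝ, ℝ) ∞ g) (hg' : ContMDiff I 𝓘(ℝ, ℝ) ∞ g') {x : N}
    (hff' : mvfderiv I f x = mvfderiv I f' x) (hgg' : mvfderiv I g x = mvfderiv I g' x) :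
    schoutenVecBivec I X Λ f g x = schoutenVecBivec I X Λ f' g' x := by
  rw [schoutenVecBivec_eq hX hΛ hf hg, hff', ← schoutenVecBivec_eq hX hΛ hf' hg,
    schoutenVecBivec_swap hΛ₀, schoutenVecBivec_eq hX hΛ hg hf', hgg',
    ← schoutenVecBivec_eq hX hΛ hg' hf', ← schoutenVecBivec_swap hΛ₀]

theorem schoutenBivec_self_congr (hΛ : ∀ x, SmoothBivecAt I Λ x) (hΛ₀ : ∀ x α, Λ x α α = 0)
    {f f' g g' h h' : N → ℝ}
    (hf : ContMDiff I 𝓘(ℝ, ℝ) ∞ f) (hf' : ContMDiff I 𝓘(ℝ, ℝ) ∞ f')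
    (hg : ContMDiff I 𝓘(ℝ, ℝ) ∞ g) (hg' : ContMDiff I 𝓘(ℝ, ℝ) ∞ g')
    (hh : ContMDiff I 𝓘(ℝ, ℝ) ∞ h) (hh' : ContMDiff I 𝓘(ℝ, ℝ) ∞ h') {x : N}
    (hff' : mvfderiv I f x = mvfderiv I f' x) (hgg' : mvfderiv I g x = mvfderiv I g' x)
    (hhh' : mvfderiv I h x = mvfderiv I h' x) :
    schoutenBivec I Λ Λ f g h x = schoutenBivec I Λ Λ f' g' h' x := by
  rw [schoutenBivec_self_eq hΛ hΛ₀ hf hg hh, hff', ← schoutenBivec_self_eq hΛ hΛ₀ hf' hg hh,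
    schoutenBivec_rotate,
    schoutenBivec_self_eq hΛ hΛ₀ hg hh hf', hgg', ← schoutenBivec_self_eq hΛ hΛ₀ hg' hh hf',
    schoutenBivec_rotate,
    schoutenBivec_self_eq hΛ hΛ₀ hh hf' hg', hhh', ← schoutenBivec_self_eq hΛ hΛ₀ hh' hf' hg',
    schoutenBivec_rotate]

end Schouten

section JacobiBracket

variable {E : Type*} [NormedAddCommGroup E] [NormedSpace ℝ E]
  {H : Type*} [TopologicalSpace H] {I : ModelWithCorners ℝ E H}
  {N : Type*} [TopologicalSpace N] [ChartedSpace H N]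
  {Λ : ∀ x : N, CotangentForm I x} {X : ∀ x : N, TangentSpace I x}

variable (I) in
/-- The bracket `{f, g} = Λ(df, dg) + f X(g) - g X(f)` of an arbitrary pair `(Λ, X)`, which need not
be a Jacobi structure; for one, it is `JacobiStructure.bracket`. -/
def jacobiBracket (Λ : ∀ x : N, CotangentForm I x) (X : ∀ x : N, TangentSpace I x)
    (f g : N → ℝ) : N → ℝ :=
  pairing I Λ f g + f * along I X g - g * along I X f

theorem mvfderiv_one (x : N) : mvfderiv I (1 : N → ℝ) x = 0 :=
  mvfderiv_const 1

theorem along_one : along I X 1 = 0 :=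
  funext fun x => congrArg (fun α : Cotangent I x => α (X x)) (mvfderiv_one x)

theorem along_zero : along I X 0 = 0 :=
  funext fun x => congrArg (fun α : Cotangent I x => α (X x)) mvfderiv_zero

theorem pairing_one_right (f : N → ℝ) : pairing I Λ f 1 = 0 := by
  funext x
  rw [pairing, mvfderiv_one, map_zero, Pi.zero_apply]

theorem pairing_zero_left (f : N → ℝ) : pairing I Λ 0 f = 0 := by
  funext x
  rw [pairing, mvfderiv_zero, map_zero, zero_apply, Pi.zero_apply]

theorem pairing_zero_right (f : N → ℝ) : pairing I Λ f 0 = 0 := by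
  funext x
  rw [pairing, mvfderiv_zero, map_zero, Pi.zero_apply]

theorem schoutenVecBivec_one_right (f : N → ℝ) (x : N) : schoutenVecBivec I X Λ f 1 x = 0 := by
  simp only [schoutenVecBivec, pairing_one_right, along_one, along_zero, pairing_zero_right,
    sub_zero, Pi.zero_apply]

theorem schoutenBivec_self_one_right (hΛ₀ : ∀ x α, Λ x α α = 0) (f g : N → ℝ) (x : N) :
    schoutenBivec I Λ Λ f g 1 x = 0 := by
  simp only [schoutenBivec, pairing_swap hΛ₀ 1 f, pairing_one_right, neg_zero, pairing_zero_left,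
    add_zero, Pi.zero_apply]

theorem jacobiBracket_one_left (hΛ₀ : ∀ x α, Λ x α α = 0) (g : N → ℝ) :
    jacobiBracket I Λ X 1 g = along I X g := by
  rw [jacobiBracket, pairing_swap hΛ₀, pairing_one_right, along_one]
  simp

theorem mvfderiv_jacobiBracket {f g : N → ℝ} {x : N}
    (hf : MDifferentiableAt I 𝓘(ℝ, ℝ) f x) (hg : MDifferentiableAt I 𝓘(ℝ, ℝ) g x)
    (hfg : MDifferentiableAt I 𝓘(ℝ, ℝ) (pairing I Λ f g) x)
    (hXf : MDifferentiableAt I 𝓘(ℝ, ℝ) (along I X f) x)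
    (hXg : MDifferentiableAt I 𝓘(ℝ, ℝ) (along I X g) x) :
    mvfderiv I (jacobiBracket I Λ X f g) x =
      mvfderiv I (pairing I Λ f g) x + f x • mvfderiv I (along I X g) x +
        along I X g x • mvfderiv I f x - g x • mvfderiv I (along I X f) x -
        along I X f x • mvfderiv I g x := by
  rw [jacobiBracket, mvfderiv_sub (hfg.add (hf.mul hXg)) (hg.mul hXf),
    mvfderiv_add hfg (hf.mul hXg), mvfderiv_mul hf hXg, mvfderiv_mul hg hXf]
  abel

theorem jacobiBracket_jacobiBracket {f g : N → ℝ} {x : N}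
    (hf : MDifferentiableAt I 𝓘(ℝ, ℝ) f x) (hg : MDifferentiableAt I 𝓘(ℝ, ℝ) g x)
    (hfg : MDifferentiableAt I 𝓘(ℝ, ℝ) (pairing I Λ f g) x)
    (hXf : MDifferentiableAt I 𝓘(ℝ, ℝ) (along I X f) x)
    (hXg : MDifferentiableAt I 𝓘(ℝ, ℝ) (along I X g) x) (h : N → ℝ) :
    jacobiBracket I Λ X (jacobiBracket I Λ X f g) h x =
      pairing I Λ (pairing I Λ f g) h x + f x * pairing I Λ (along I X g) h x +
        along I X g x * pairing I Λ f h x - g x * pairing I Λ (along I X f) h x -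
        along I X f x * pairing I Λ g h x + jacobiBracket I Λ X f g x * along I X h x -
        h x * (along I X (pairing I Λ f g) x + f x * along I X (along I X g) x -
          g x * along I X (along I X f) x) := by
  rw [jacobiBracket]
  simp only [pairing, along, Pi.add_apply, Pi.sub_apply, Pi.mul_apply]
  rw [mvfderiv_jacobiBracket hf hg hfg hXf hXg]
  simp only [map_add, map_sub, map_smul, add_apply, sub_apply, smul_apply, smul_eq_mul, along]
  ring

theorem jacobiBracket_cyclic_sum [IsManifold I ∞ N]
    (hX : ContMDiff I I.tangent ∞ (fun x => (⟨x, X x⟩ : TangentBundle I N)))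
    (hΛ : ∀ x, SmoothBivecAt I Λ x) (hΛ₀ : ∀ x α, Λ x α α = 0) {f g h : N → ℝ}
    (hf : ContMDiff I 𝓘(ℝ, ℝ) ∞ f) (hg : ContMDiff I 𝓘(ℝ, ℝ) ∞ g)
    (hh : ContMDiff I 𝓘(ℝ, ℝ) ∞ h) (x : N) :
    2 * (jacobiBracket I Λ X (jacobiBracket I Λ X f g) h x +
        jacobiBracket I Λ X (jacobiBracket I Λ X g h) f x +
        jacobiBracket I Λ X (jacobiBracket I Λ X h f) g x) =
      schoutenBivec I Λ Λ f g h x -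
        2 * wedgeVecBivec I (X x) (Λ x) (mvfderiv I f x) (mvfderiv I g x) (mvfderiv I h x) -
        2 * (f x * schoutenVecBivec I X Λ g h x + g x * schoutenVecBivec I X Λ h f x +
          h x * schoutenVecBivec I X Λ f g x) := by
  have hd {u : N → ℝ} (hu : ContMDiff I 𝓘(ℝ, ℝ) ∞ u) : MDifferentiableAt I 𝓘(ℝ, ℝ) u x :=
    (hu x).mdifferentiableAt (by simp)
  have hdΛ {u v : N → ℝ} (hu : ContMDiff I 𝓘(ℝ, ℝ) ∞ u) (hv : ContMDiff I 𝓘(ℝ, ℝ) ∞ v) :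
      MDifferentiableAt I 𝓘(ℝ, ℝ) (pairing I Λ u v) x :=
    (contMDiffAt_pairing (hΛ x) (hu x) (hv x)).mdifferentiableAt (by simp)
  have hdX {u : N → ℝ} (hu : ContMDiff I 𝓘(ℝ, ℝ) ∞ u) :
      MDifferentiableAt I 𝓘(ℝ, ℝ) (along I X u) x := hd (contMDiff_along hX hu)
  rw [jacobiBracket_jacobiBracket (hd hf) (hd hg) (hdΛ hf hg) (hdX hf) (hdX hg),
    jacobiBracket_jacobiBracket (hd hg) (hd hh) (hdΛ hg hh) (hdX hg) (hdX hh),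
    jacobiBracket_jacobiBracket (hd hh) (hd hf) (hdΛ hh hf) (hdX hh) (hdX hf)]
  have hwedge :
      wedgeVecBivec I (X x) (Λ x) (mvfderiv I f x) (mvfderiv I g x) (mvfderiv I h x) =
        along I X f x * pairing I Λ g h x + along I X g x * pairing I Λ h f x +
          along I X h x * pairing I Λ f g x := rfl
  have hswap (u v : N → ℝ) : pairing I Λ u v x = -pairing I Λ v u x :=
    congrFun (pairing_swap hΛ₀ u v) x
  simp only [hwedge, schoutenBivec, schoutenVecBivec, jacobiBracket, Pi.add_apply, Pi.sub_apply,
    Pi.mul_apply]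
  linear_combination 2 * along I X g x * hswap f h + 2 * along I X h x * hswap g f +
    2 * along I X f x * hswap h g - 2 * g x * hswap (along I X f) h -
    2 * h x * hswap (along I X g) f - 2 * f x * hswap (along I X h) g

end JacobiBracket

section Bilinearity

variable {E : Type*} [NormedAddCommGroup E] [NormedSpace ℝ E]
  {H : Type*} [TopologicalSpace H] {I : ModelWithCorners ℝ E H}
  {N : Type*} [TopologicalSpace N] [ChartedSpace H N]
  {Λ : ∀ x : N, CotangentForm I x} {X : ∀ x : N, TangentSpace I x}

theorem wedgeVec_apply {x : N} (X Y : TangentSpace I x) (α β : Cotangent I x) :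
    wedgeVec I X Y α β = α X * β Y - α Y * β X := rfl

theorem pairing_add_left {f g : N → ℝ} {x : N} (hf : MDifferentiableAt I 𝓘(ℝ, ℝ) f x)
    (hg : MDifferentiableAt I 𝓘(ℝ, ℝ) g x) (h : N → ℝ) :
    pairing I Λ (f + g) h x = pairing I Λ f h x + pairing I Λ g h x := by
  simp only [pairing, mvfderiv_add hf hg, map_add, add_apply]

theorem pairing_mul_left {f g : N → ℝ} {x : N} (hf : MDifferentiableAt I 𝓘(ℝ, ℝ) f x)
    (hg : MDifferentiableAt I 𝓘(ℝ, ℝ) g x) (h : N → ℝ) :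
    pairing I Λ (f * g) h x = f x * pairing I Λ g h x + g x * pairing I Λ f h x := by
  simp only [pairing, mvfderiv_mul hf hg, map_add, map_smul, add_apply, smul_apply, smul_eq_mul]

theorem along_add {f g : N → ℝ} {x : N} (hf : MDifferentiableAt I 𝓘(ℝ, ℝ) f x)
    (hg : MDifferentiableAt I 𝓘(ℝ, ℝ) g x) :
    along I X (f + g) x = along I X f x + along I X g x := by
  simp only [along, mvfderiv_add hf hg, add_apply]

theorem along_mul {f g : N → ℝ} {x : N} (hf : MDifferentiableAt I 𝓘(ℝ, ℝ) f x)
    (hg : MDifferentiableAt I 𝓘(ℝ, ℝ) g x) :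
    along I X (f * g) x = f x * along I X g x + g x * along I X f x := by
  simp only [along, mvfderiv_mul hf hg, add_apply, smul_apply, smul_eq_mul]

theorem along_const_smul (c : ℝ) {f : N → ℝ} {x : N} (hf : MDifferentiableAt I 𝓘(ℝ, ℝ) f x) :
    along I X (c • f) x = c * along I X f x := by
  have h : along I X ((fun _ => c) * f) x = _ := along_mul mdifferentiableAt_const hf
  have hc : along I X (fun _ => c) x = 0 := by simp only [along, mvfderiv_const, zero_apply]
  rwa [hc, mul_zero, add_zero] at h

theorem jacobiBracket_swap (hΛ₀ : ∀ x α, Λ x α α = 0) (f g : N → ℝ) :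
    jacobiBracket I Λ X f g = -jacobiBracket I Λ X g f := by
  rw [jacobiBracket, jacobiBracket, pairing_swap hΛ₀]
  abel

theorem jacobiBracket_add_left {f g : N → ℝ} (hf : MDifferentiable I 𝓘(ℝ, ℝ) f)
    (hg : MDifferentiable I 𝓘(ℝ, ℝ) g) (h : N → ℝ) :
    jacobiBracket I Λ X (f + g) h = jacobiBracket I Λ X f h + jacobiBracket I Λ X g h := by
  funext x
  simp only [jacobiBracket, Pi.add_apply, Pi.sub_apply, Pi.mul_apply,
    pairing_add_left (hf x) (hg x), along_add (hf x) (hg x)]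
  ring

theorem jacobiBracket_add_right (hΛ₀ : ∀ x α, Λ x α α = 0) {g h : N → ℝ}
    (hg : MDifferentiable I 𝓘(ℝ, ℝ) g) (hh : MDifferentiable I 𝓘(ℝ, ℝ) h) (f : N → ℝ) :
    jacobiBracket I Λ X f (g + h) = jacobiBracket I Λ X f g + jacobiBracket I Λ X f h := by
  rw [jacobiBracket_swap hΛ₀, jacobiBracket_add_left hg hh, neg_add, ← jacobiBracket_swap hΛ₀,
    ← jacobiBracket_swap hΛ₀]

end Bilinearity

section Generators

variable {E : Type*} [NormedAddCommGroup E] [NormedSpace ℝ E]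
  {H : Type*} [TopologicalSpace H] {I : ModelWithCorners ℝ E H}
  {N : Type*} [TopologicalSpace N] [ChartedSpace H N]

variable (I) in
/-- A set of smooth functions which, near every point, contains every linear combination of the
coordinates of the preferred chart. Multivector fields are determined by their values on such
functions. -/
structure GeneratesCoordinates (𝒢 : Set (N → ℝ)) : Prop where
  contMDiff : ∀ f ∈ 𝒢, ContMDiff I 𝓘(ℝ, ℝ) ∞ f
  exists_eventuallyEq : ∀ (x : N) (α : E →L[ℝ] ℝ),
    ∃ f ∈ 𝒢, (fun y => α (extChartAt I x y)) =ᶠ[𝓝 x] f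

namespace GeneratesCoordinates

variable {𝒢 : Set (N → ℝ)} (h𝒢 : GeneratesCoordinates I 𝒢)
include h𝒢

theorem exists_eventually_mvfderiv_eq (x : N) (α : E →L[ℝ] ℝ) : ∃ f ∈ 𝒢,
    ∀ᶠ y in 𝓝 x, mvfderiv I (fun y => α (extChartAt I x y)) y = mvfderiv I f y := by
  obtain ⟨f, hf, h⟩ := h𝒢.exists_eventuallyEq x α
  exact ⟨f, hf, h.eventuallyEq_nhds.mono fun y hy => mvfderiv_congr_of_eventuallyEq hy⟩

variable [IsManifold I ∞ N]

theorem exists_mvfderiv_eq (x : N) (α : Cotangent I x) : ∃ f ∈ 𝒢, α = mvfderiv I f x := by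
  obtain ⟨f, hf, h⟩ := h𝒢.exists_eventually_mvfderiv_eq x α
  refine ⟨f, hf, Eq.trans ?_ h.self_of_nhds⟩
  ext v
  refine Eq.trans ?_ (congrArg (fun β : E →L[ℝ] ℝ => β v) (mvfderiv_clm_comp (V := E) α
    (mdifferentiableAt_extChartAt (mem_chart_source H x)))).symm
  exact congrArg (fun L : E →L[ℝ] E => α (L v)) (mfderiv_extChartAt_self (I := I) (x := x)).symm

theorem vec_ext {x : N} {v w : TangentSpace I x}
    (h : ∀ f ∈ 𝒢, mvfderiv I f x v = mvfderiv I f x w) : v = w := by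
  refine (SeparatingDual.eq_iff_forall_dual_eq (R := ℝ) (V := E)).2 fun α => ?_
  obtain ⟨f, hf, hα⟩ := h𝒢.exists_mvfderiv_eq x α
  exact (congrArg (fun β : E →L[ℝ] ℝ => β v) hα).trans
    ((h f hf).trans (congrArg (fun β : E →L[ℝ] ℝ => β w) hα).symm)

theorem bivec_ext {x : N} {P Q : CotangentForm I x}
    (h : ∀ f ∈ 𝒢, ∀ g ∈ 𝒢, P (mvfderiv I f x) (mvfderiv I g x) =
      Q (mvfderiv I f x) (mvfderiv I g x)) : P = Q := by
  ext α β
  obtain ⟨f, hf, rfl⟩ := h𝒢.exists_mvfderiv_eq x α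
  obtain ⟨g, hg, rfl⟩ := h𝒢.exists_mvfderiv_eq x β
  exact h f hf g hg

variable [FiniteDimensional ℝ E] {Λ : ∀ x : N, CotangentForm I x} {X : ∀ x : N, TangentSpace I x}

theorem contMDiff_vec (h : ∀ f ∈ 𝒢, ContMDiff I 𝓘(ℝ, ℝ) ∞ (along I X f)) :
    ContMDiff I I.tangent ∞ (fun x => (⟨x, X x⟩ : TangentBundle I N)) := fun x =>
  contMDiffAt_vectorField_of_coord fun α => by
    obtain ⟨f, hf, hα⟩ := h𝒢.exists_eventually_mvfderiv_eq x α
    exact (h f hf x).congr_of_eventuallyEq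
      (hα.mono fun y hy => congrArg (fun β : Cotangent I y => β (X y)) hy)

theorem smoothBivecAt (h : ∀ f ∈ 𝒢, ∀ g ∈ 𝒢, ContMDiff I 𝓘(ℝ, ℝ) ∞ (pairing I Λ f g)) (x : N) :
    SmoothBivecAt I Λ x :=
  contMDiffAt_bivec_of_coord fun α β => by
    obtain ⟨f, hf, hα⟩ := h𝒢.exists_eventually_mvfderiv_eq x α
    obtain ⟨g, hg, hβ⟩ := h𝒢.exists_eventually_mvfderiv_eq x β
    refine (h f hf g hg x).congr_of_eventuallyEq ?_
    filter_upwards [hα, hβ] with y hα hβ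
    rw [pairing, pairing, hα, hβ]

omit [FiniteDimensional ℝ E] in
theorem jacobiStructure_ext (h1 : 1 ∈ 𝒢) {J J' : JacobiStructure I N}
    (h : ∀ f ∈ 𝒢, ∀ g ∈ 𝒢, J.bracket f g = J'.bracket f g) : J = J' := by
  have hvec : J.vec = J'.vec := funext fun x => h𝒢.vec_ext fun f hf =>
    congrFun ((jacobiBracket_one_left J.bivec_self f).symm.trans
      ((h 1 h1 f hf).trans (jacobiBracket_one_left J'.bivec_self f))) x
  refine JacobiStructure.ext (funext fun x => h𝒢.bivec_ext fun f hf g hg => ?_) hvec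
  have hfg := congrFun (h f hf g hg) x
  simp only [JacobiStructure.bracket, hvec, Pi.add_apply, Pi.sub_apply] at hfg
  exact add_right_cancel (sub_left_inj.1 hfg)

variable [I.Boundaryless]

theorem schoutenVecBivec_eq_zero
    (hX : ContMDiff I I.tangent ∞ (fun x => (⟨x, X x⟩ : TangentBundle I N)))
    (hΛ : ∀ x, SmoothBivecAt I Λ x) (hΛ₀ : ∀ x α, Λ x α α = 0)
    (h : ∀ f ∈ 𝒢, ∀ g ∈ 𝒢, ∀ x, schoutenVecBivec I X Λ f g x = 0) {f g : N → ℝ}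
    (hf : ContMDiff I 𝓘(ℝ, ℝ) ∞ f) (hg : ContMDiff I 𝓘(ℝ, ℝ) ∞ g) (x : N) :
    schoutenVecBivec I X Λ f g x = 0 := by
  obtain ⟨f', hf', hff'⟩ := h𝒢.exists_mvfderiv_eq x (mvfderiv I f x)
  obtain ⟨g', hg', hgg'⟩ := h𝒢.exists_mvfderiv_eq x (mvfderiv I g x)
  rw [schoutenVecBivec_congr hX hΛ hΛ₀ hf (h𝒢.contMDiff f' hf') hg (h𝒢.contMDiff g' hg') hff' hgg']
  exact h f' hf' g' hg' x

theorem schoutenBivec_self_eq_wedge (hΛ : ∀ x, SmoothBivecAt I Λ x) (hΛ₀ : ∀ x α, Λ x α α = 0)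
    (h : ∀ f ∈ 𝒢, ∀ g ∈ 𝒢, ∀ h ∈ 𝒢, ∀ x, schoutenBivec I Λ Λ f g h x =
      2 * wedgeVecBivec I (X x) (Λ x) (mvfderiv I f x) (mvfderiv I g x) (mvfderiv I h x))
    {f g k : N → ℝ} (hf : ContMDiff I 𝓘(ℝ, ℝ) ∞ f) (hg : ContMDiff I 𝓘(ℝ, ℝ) ∞ g)
    (hk : ContMDiff I 𝓘(ℝ, ℝ) ∞ k) (x : N) :
    schoutenBivec I Λ Λ f g k x =
      2 * wedgeVecBivec I (X x) (Λ x) (mvfderiv I f x) (mvfderiv I g x) (mvfderiv I k x) := by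
  obtain ⟨f', hf', hff'⟩ := h𝒢.exists_mvfderiv_eq x (mvfderiv I f x)
  obtain ⟨g', hg', hgg'⟩ := h𝒢.exists_mvfderiv_eq x (mvfderiv I g x)
  obtain ⟨k', hk', hkk'⟩ := h𝒢.exists_mvfderiv_eq x (mvfderiv I k x)
  rw [schoutenBivec_self_congr hΛ hΛ₀ hf (h𝒢.contMDiff f' hf') hg (h𝒢.contMDiff g' hg') hk
    (h𝒢.contMDiff k' hk') hff' hgg' hkk', hff', hgg', hkk']
  exact h f' hf' g' hg' k' hk' x

end GeneratesCoordinates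

end Generators

section OfGenerators

variable {E : Type*} [NormedAddCommGroup E] [NormedSpace ℝ E]
  {H : Type*} [TopologicalSpace H] {I : ModelWithCorners ℝ E H}
  {N : Type*} [TopologicalSpace N] [ChartedSpace H N]
  {Λ : ∀ x : N, CotangentForm I x} {X : ∀ x : N, TangentSpace I x} {𝒢 : Set (N → ℝ)}

theorem contMDiff_along_of_jacobiBracket (hΛ₀ : ∀ x α, Λ x α α = 0) (h1 : 1 ∈ 𝒢)
    (hbr : ∀ f ∈ 𝒢, ∀ g ∈ 𝒢, ContMDiff I 𝓘(ℝ, ℝ) ∞ (jacobiBracket I Λ X f g))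
    {f : N → ℝ} (hf : f ∈ 𝒢) : ContMDiff I 𝓘(ℝ, ℝ) ∞ (along I X f) :=
  jacobiBracket_one_left (X := X) hΛ₀ f ▸ hbr 1 h1 f hf

theorem contMDiff_pairing_of_jacobiBracket (hΛ₀ : ∀ x α, Λ x α α = 0)
    (h𝒢 : ∀ f ∈ 𝒢, ContMDiff I 𝓘(ℝ, ℝ) ∞ f) (h1 : 1 ∈ 𝒢)
    (hbr : ∀ f ∈ 𝒢, ∀ g ∈ 𝒢, ContMDiff I 𝓘(ℝ, ℝ) ∞ (jacobiBracket I Λ X f g))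
    {f g : N → ℝ} (hf : f ∈ 𝒢) (hg : g ∈ 𝒢) : ContMDiff I 𝓘(ℝ, ℝ) ∞ (pairing I Λ f g) := by
  have h := ((hbr f hf g hg).add
    ((h𝒢 g hg).mul (contMDiff_along_of_jacobiBracket hΛ₀ h1 hbr hf))).sub
    ((h𝒢 f hf).mul (contMDiff_along_of_jacobiBracket hΛ₀ h1 hbr hg))
  convert h using 1
  funext x
  simp only [jacobiBracket, Pi.add_apply, Pi.sub_apply, Pi.mul_apply]
  ring

variable [FiniteDimensional ℝ E] [I.Boundaryless] [IsManifold I ∞ N]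

/-- The Jacobi structure given by a pair `(Λ, X)` whose bracket, restricted to a set of functions
that contains `1` and generates the coordinates, is smooth and satisfies the Jacobi identity. -/
def JacobiStructure.ofGenerators (Λ : ∀ x : N, CotangentForm I x) (X : ∀ x : N, TangentSpace I x)
    (hΛ₀ : ∀ x α, Λ x α α = 0) (h𝒢 : GeneratesCoordinates I 𝒢) (h1 : 1 ∈ 𝒢)
    (hbr : ∀ f ∈ 𝒢, ∀ g ∈ 𝒢, ContMDiff I 𝓘(ℝ, ℝ) ∞ (jacobiBracket I Λ X f g))
    (hjac : ∀ f ∈ 𝒢, ∀ g ∈ 𝒢, ∀ h ∈ 𝒢, ∀ x,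
      jacobiBracket I Λ X (jacobiBracket I Λ X f g) h x +
        jacobiBracket I Λ X (jacobiBracket I Λ X g h) f x +
        jacobiBracket I Λ X (jacobiBracket I Λ X h f) g x = 0) :
    JacobiStructure I N :=
  have hX := h𝒢.contMDiff_vec fun _ hf => contMDiff_along_of_jacobiBracket hΛ₀ h1 hbr hf
  have hΛ := h𝒢.smoothBivecAt fun _ hf _ hg =>
    contMDiff_pairing_of_jacobiBracket hΛ₀ h𝒢.contMDiff h1 hbr hf hg
  have hcyc {f g h} (hf : f ∈ 𝒢) (hg : g ∈ 𝒢) (hh : h ∈ 𝒢) :=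
    jacobiBracket_cyclic_sum hX hΛ hΛ₀ (h𝒢.contMDiff f hf) (h𝒢.contMDiff g hg) (h𝒢.contMDiff h hh)
  have hvec : ∀ f ∈ 𝒢, ∀ g ∈ 𝒢, ∀ x, schoutenVecBivec I X Λ f g x = 0 := fun f hf g hg x => by
    have h := hcyc hf hg h1 x
    rw [hjac f hf g hg 1 h1 x] at h
    rw [schoutenBivec_self_one_right hΛ₀, schoutenVecBivec_one_right,
      schoutenVecBivec_swap hΛ₀ 1, schoutenVecBivec_one_right, wedgeVecBivec, mvfderiv_one] at h
    simp only [map_zero, zero_apply, Pi.one_apply] at h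
    linarith
  have hself : ∀ f ∈ 𝒢, ∀ g ∈ 𝒢, ∀ h ∈ 𝒢, ∀ x, schoutenBivec I Λ Λ f g h x =
      2 * wedgeVecBivec I (X x) (Λ x) (mvfderiv I f x) (mvfderiv I g x) (mvfderiv I h x) :=
    fun f hf g hg h hh x => by
      have h := hcyc hf hg hh x
      rw [hjac f hf g hg _ hh x, hvec f hf g hg, hvec g hg _ hh, hvec _ hh f hf] at h
      linarith
  { bivec := Λ
    vec := X
    bivec_self := hΛ₀
    bivec_smooth := hΛ
    vec_smooth := hX
    schouten_self := fun _ _ _ hf hg hh => h𝒢.schoutenBivec_self_eq_wedge hΛ hΛ₀ hself hf hg hh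
    schouten_vec := fun _ _ hf hg => h𝒢.schoutenVecBivec_eq_zero hX hΛ hΛ₀ hvec hf hg }

end OfGenerators

section DualBundle

variable {E : Type*} [NormedAddCommGroup E] [NormedSpace ℝ E]
  {M : Type*} [TopologicalSpace M] [ChartedSpace E M]
  {F : Type*} [NormedAddCommGroup F] [NormedSpace ℝ F]
  {A : M → Type*} [∀ x, AddCommGroup (A x)] [∀ x, Module ℝ (A x)] [∀ x, TopologicalSpace (A x)]
  [TopologicalSpace (TotalSpace F A)] [FiberBundle F A] [VectorBundle ℝ F A]

theorem extChartAt_dualBundle {p q : DualBundle F A}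
    (h : q.1 ∈ (trivializationAt F A p.1).baseSet) :
    extChartAt (dualModel E F) p q =
      (extChartAt 𝓘(ℝ, E) p.1 q.1, q.2 ∘L (trivializationAt F A p.1).symmL ℝ q.1) := by
  rw [← dual_trivializationAt_snd, FiberBundle.extChartAt]
  simp only [PartialEquiv.trans_apply, PartialEquiv.prod_coe, PartialEquiv.refl_coe, id]
  rw [OpenPartialHomeomorph.toFun_eq_coe, Trivialization.coe_coe,
    Trivialization.coe_fst' _ (mem_baseSet_dual_trivializationAt h)]

theorem contMDiff_basicFunction {f : M → ℝ} (hf : ContMDiff 𝓘(ℝ, E) 𝓘(ℝ, ℝ) ∞ f) :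
    ContMDiff (dualModel E F) 𝓘(ℝ, ℝ) ∞ (basicFunction F A f) :=
  hf.comp (contMDiff_proj (IB := 𝓘(ℝ, E)) (F := F →L[ℝ] ℝ) (DualFiber A))

theorem contMDiff_dual_apply {B : Type*} [NormedAddCommGroup B] [NormedSpace ℝ B]
    {H : Type*} [TopologicalSpace H] {J : ModelWithCorners ℝ B H}
    {N : Type*} [TopologicalSpace N] [ChartedSpace H N] {b : N → M} {θ : ∀ m, DualFiber A (b m)}
    {v : ∀ m, A (b m)}
    (hθ : ContMDiff J (dualModel E F) ∞ (fun m => (⟨b m, θ m⟩ : DualBundle F A)))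
    (hv : ContMDiff J (𝓘(ℝ, E).prod 𝓘(ℝ, F)) ∞ (fun m => (⟨b m, v m⟩ : TotalSpace F A))) :
    ContMDiff J 𝓘(ℝ, ℝ) ∞ (fun m => θ m (v m)) := by
  have h := ContMDiff.clm_bundle_apply (F₂ := ℝ) (E₂ := Bundle.Trivial M ℝ) hθ hv
  intro m
  exact ((contMDiffAt_totalSpace).1 (h m)).2

theorem contMDiff_dualSection_apply (φ : DualSections E F A) (μ : GlobalSections E F A) :
    ContMDiff 𝓘(ℝ, E) 𝓘(ℝ, ℝ) ∞ (fun x => φ x (μ x)) :=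
  contMDiff_dual_apply φ.contMDiff μ.contMDiff

theorem contMDiff_linearFunction (μ : GlobalSections E F A) :
    ContMDiff (dualModel E F) 𝓘(ℝ, ℝ) ∞ (linearFunction μ) :=
  contMDiff_dual_apply contMDiff_id
    (μ.contMDiff.comp (contMDiff_proj (IB := 𝓘(ℝ, E)) (F := F →L[ℝ] ℝ) (DualFiber A)))

theorem mdifferentiableAt_linearFunction (μ : GlobalSections E F A) (p : DualBundle F A) :
    MDifferentiableAt (dualModel E F) 𝓘(ℝ, ℝ) (linearFunction μ) p :=
  (contMDiff_linearFunction μ p).mdifferentiableAt (by simp)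

theorem mdifferentiableAt_basicFunction {f : M → ℝ} (hf : ContMDiff 𝓘(ℝ, E) 𝓘(ℝ, ℝ) ∞ f)
    (p : DualBundle F A) :
    MDifferentiableAt (dualModel E F) 𝓘(ℝ, ℝ) (basicFunction F A f) p :=
  (contMDiff_basicFunction hf p).mdifferentiableAt (by simp)

theorem mdifferentiableAt_vertical_line (p : DualBundle F A) (θ : DualFiber A p.1) :
    MDifferentiableAt 𝓘(ℝ, ℝ) (dualModel E F)
      (fun t : ℝ => (⟨p.1, p.2 + t • θ⟩ : DualBundle F A)) 0 := by
  refine ContMDiffAt.mdifferentiableAt (n := 1) ?_ (by simp)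
  rw [contMDiffAt_totalSpace]
  refine ⟨contMDiffAt_const, ?_⟩
  have h : (fun t : ℝ => (trivializationAt (F →L[ℝ] ℝ) (DualFiber A) p.1 ⟨p.1, p.2 + t • θ⟩).2) =
      fun t : ℝ => p.2 ∘L (trivializationAt F A p.1).symmL ℝ p.1 +
        t • (θ ∘L (trivializationAt F A p.1).symmL ℝ p.1) := by
    funext t
    rw [dual_trivializationAt_snd]
    rfl
  dsimp only
  rw [h]
  exact contMDiffAt_const.add (contMDiffAt_id.smul contMDiffAt_const)

theorem mvfderiv_verticalVec {f : DualBundle F A → ℝ} {p : DualBundle F A}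
    (hf : MDifferentiableAt (dualModel E F) 𝓘(ℝ, ℝ) f p) (θ : DualFiber A p.1) :
    mvfderiv (dualModel E F) f p (verticalVec E p θ) =
      deriv (fun t : ℝ => f ⟨p.1, p.2 + t • θ⟩) 0 := by
  have hp : (⟨p.1, p.2 + (0 : ℝ) • θ⟩ : DualBundle F A) = p := by rw [zero_smul, add_zero]
  have h := mvfderiv_comp_apply_of_eq (I' := 𝓘(ℝ, ℝ)) (I := dualModel E F) (0 : ℝ) hf
    (mdifferentiableAt_vertical_line p θ) hp (1 : ℝ)
  refine h.symm.trans ?_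
  simp only [mvfderiv, mfderiv_eq_fderiv]
  exact fderiv_apply_one_eq_deriv (𝕜 := ℝ) (f := fun t : ℝ => f ⟨p.1, p.2 + t • θ⟩)

theorem mvfderiv_linearFunction_verticalVec (μ : GlobalSections E F A) (p : DualBundle F A)
    (θ : DualFiber A p.1) :
    mvfderiv (dualModel E F) (linearFunction μ) p (verticalVec E p θ) = θ (μ p.1) := by
  rw [mvfderiv_verticalVec (mdifferentiableAt_linearFunction μ p)]
  have h : HasDerivAt (fun t : ℝ => p.2 (μ p.1) + t * θ (μ p.1)) (θ (μ p.1)) 0 := by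
    simpa using ((hasDerivAt_id (0 : ℝ)).mul_const (θ (μ p.1))).const_add (p.2 (μ p.1))
  simp only [linearFunction, add_apply, smul_apply, smul_eq_mul]
  exact h.deriv

theorem mvfderiv_basicFunction_verticalVec {f : M → ℝ} (hf : ContMDiff 𝓘(ℝ, E) 𝓘(ℝ, ℝ) ∞ f)
    (p : DualBundle F A) (θ : DualFiber A p.1) :
    mvfderiv (dualModel E F) (basicFunction F A f) p (verticalVec E p θ) = 0 := by
  rw [mvfderiv_verticalVec (mdifferentiableAt_basicFunction hf p)]
  simp [basicFunction]

theorem mvfderiv_coordVec {f : DualBundle F A → ℝ} {p : DualBundle F A}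
    (hf : MDifferentiableAt (dualModel E F) 𝓘(ℝ, ℝ) f p) (v : TangentSpace 𝓘(ℝ, E) p.1) :
    mvfderiv (dualModel E F) f p (coordVec p v) =
      mvfderiv 𝓘(ℝ, E) (fun y => f ⟨y, FiberBundle.extend (F →L[ℝ] ℝ) p.2 y⟩) p.1 v := by
  have hp : (⟨p.1, FiberBundle.extend (F →L[ℝ] ℝ) p.2 p.1⟩ : DualBundle F A) = p := by
    rw [FiberBundle.extend_apply_self]
  have hs : MDifferentiableAt 𝓘(ℝ, E) (dualModel E F) (fun y : M =>
      (⟨y, FiberBundle.extend (F →L[ℝ] ℝ) p.2 y⟩ : DualBundle F A)) p.1 :=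
    (FiberBundle.contMDiffAt_extend 𝓘(ℝ, E) (F →L[ℝ] ℝ) (k := 1) p.2).mdifferentiableAt (by simp)
  exact (mvfderiv_comp_apply_of_eq (I' := 𝓘(ℝ, E)) (I := dualModel E F) p.1 hf hs hp v).symm

theorem mvfderiv_basicFunction_coordVec {f : M → ℝ} (hf : ContMDiff 𝓘(ℝ, E) 𝓘(ℝ, ℝ) ∞ f)
    (p : DualBundle F A) (v : TangentSpace 𝓘(ℝ, E) p.1) :
    mvfderiv (dualModel E F) (basicFunction F A f) p (coordVec p v) = mvfderiv 𝓘(ℝ, E) f p.1 v := by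
  rw [mvfderiv_coordVec (mdifferentiableAt_basicFunction hf p)]
  rfl

/-- The smooth function `φ(μ)` on `M`, the pairing of a section of `A*` with a section of `A`. -/
def dualApply (φ : DualSections E F A) (μ : GlobalSections E F A) : C^∞⟮𝓘(ℝ, E), M; ℝ⟯ :=
  ⟨fun x => φ x (μ x), contMDiff_dualSection_apply φ μ⟩

/-- The function `μ̃ + f ∘ π*` on `A*`, affine on each fibre, of a section `μ` of `A` and a function
`f` on `M`. -/
def affineFunction :
    GlobalSections E F A × C^∞⟮𝓘(ℝ, E), M; ℝ⟯ →ₗ[ℝ] DualBundle F A → ℝ where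
  toFun s := linearFunction s.1 + basicFunction F A s.2
  map_add' s t := by
    funext p
    simp only [linearFunction, basicFunction, Pi.add_apply, Prod.fst_add, Prod.snd_add,
      ContMDiffSection.coe_add, ContMDiffMap.coe_add, map_add]
    ring
  map_smul' c s := by
    funext p
    simp only [linearFunction, basicFunction, Pi.add_apply, Pi.smul_apply, Prod.smul_fst,
      Prod.smul_snd, ContMDiffSection.coe_smul, ContMDiffMap.coe_smul, map_smul, smul_add,
      RingHom.id_apply]

theorem affineFunction_apply (s : GlobalSections E F A × C^∞⟮𝓘(ℝ, E), M; ℝ⟯) :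
    affineFunction s = linearFunction s.1 + basicFunction F A s.2 := rfl

theorem contMDiff_affineFunction (s : GlobalSections E F A × C^∞⟮𝓘(ℝ, E), M; ℝ⟯) :
    ContMDiff (dualModel E F) 𝓘(ℝ, ℝ) ∞ (affineFunction s) :=
  (contMDiff_linearFunction s.1).add (contMDiff_basicFunction s.2.contMDiff)

theorem one_mem_range_affineFunction :
    1 ∈ Set.range (affineFunction (E := E) (F := F) (A := A)) :=
  ⟨(0, 1), funext fun p => by simp [affineFunction_apply, linearFunction, basicFunction]⟩

variable [FiniteDimensional ℝ E] [T2Space M] [IsManifold 𝓘(ℝ, E) ∞ M]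
  [ContMDiffVectorBundle ∞ F A 𝓘(ℝ, E)]

theorem frameSection_eventuallyEq (x : M) (u : F) :
    ∀ᶠ y in 𝓝 x, frameSection E A x u y = (trivializationAt F A x).symm y u :=
  (exists_frameSection E A x u).choose_spec

theorem frameSection_self (x : M) (u : F) :
    frameSection E A x u x = (trivializationAt F A x).symm x u :=
  (frameSection_eventuallyEq x u).self_of_nhds

theorem mvfderiv_linearFunction_frameSection_coordVec (p : DualBundle F A) (u : F)
    (v : TangentSpace 𝓘(ℝ, E) p.1) :
    mvfderiv (dualModel E F) (linearFunction (frameSection E A p.1 u)) p (coordVec p v) = 0 := by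
  rw [mvfderiv_coordVec (mdifferentiableAt_linearFunction _ p)]
  set w := (trivializationAt (F →L[ℝ] ℝ) (DualFiber A) p.1 ⟨p.1, p.2⟩).2
  have hev : (fun y => linearFunction (frameSection E A p.1 u)
      ⟨y, FiberBundle.extend (F →L[ℝ] ℝ) p.2 y⟩) =ᶠ[𝓝 p.1] fun _ => w u := by
    have hb := (trivializationAt F A p.1).open_baseSet.mem_nhds
      (FiberBundle.mem_baseSet_trivializationAt' p.1)
    filter_upwards [frameSection_eventuallyEq (E := E) (A := A) p.1 u, hb] with y hy hyb
    have h1 : FiberBundle.extend (F →L[ℝ] ℝ) p.2 y =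
        w ∘L (trivializationAt F A p.1).continuousLinearMapAt ℝ y := by
      rw [← dual_symmL hyb, Trivialization.symmL_apply]
      · rfl
      · exact mem_baseSet_dual_trivializationAt hyb
    simp only [linearFunction, hy, h1]
    simp [hyb]
  rw [mvfderiv_congr_of_eventuallyEq hev, mvfderiv_const]
  rfl

theorem exists_contMDiffMap_eventuallyEq_clm_extChartAt (x : M) (β : E →L[ℝ] ℝ) :
    ∃ g : C^∞⟮𝓘(ℝ, E), M; ℝ⟯, g =ᶠ[𝓝 x] fun y => β (extChartAt 𝓘(ℝ, E) x y) := by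
  obtain ⟨b⟩ : Nonempty (SmoothBumpFunction 𝓘(ℝ, E) x) := inferInstance
  refine ⟨⟨fun y => b y • β (extChartAt 𝓘(ℝ, E) x y),
    b.contMDiff_smul (β.contMDiff.comp_contMDiffOn contMDiffOn_extChartAt)⟩, ?_⟩
  filter_upwards [b.eventuallyEq_one] with y hy
  simp [show b y = 1 from hy]

theorem generatesCoordinates_range_affineFunction [FiniteDimensional ℝ F] :
    GeneratesCoordinates (dualModel E F)
      (Set.range (affineFunction (E := E) (F := F) (A := A))) where
  contMDiff := by
    rintro _ ⟨s, rfl⟩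
    exact contMDiff_affineFunction s
  exists_eventuallyEq p α := by
    let t := trivializationAt F A p.1
    obtain ⟨u, hu⟩ := exists_forall_clm_apply_eq (V := F)
      (α ∘L ContinuousLinearMap.inr ℝ E (F →L[ℝ] ℝ)).toLinearMap
    obtain ⟨g, hg⟩ := exists_contMDiffMap_eventuallyEq_clm_extChartAt p.1
      (α ∘L ContinuousLinearMap.inl ℝ E (F →L[ℝ] ℝ))
    refine ⟨_, ⟨(frameSection E A p.1 u, g), rfl⟩, ?_⟩
    have hc : Filter.Tendsto (fun q : DualBundle F A => q.1) (𝓝 p) (𝓝 p.1) :=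
      (FiberBundle.continuous_proj (F →L[ℝ] ℝ) (DualFiber A)).continuousAt
    have ht : t.baseSet ∈ 𝓝 p.1 := t.open_baseSet.mem_nhds
      (FiberBundle.mem_baseSet_trivializationAt' p.1)
    filter_upwards [hc.eventually hg, hc.eventually ht,
      hc.eventually (frameSection_eventuallyEq (E := E) (A := A) p.1 u)] with q hgq htq hsq
    have hu' := hu (q.2 ∘L t.symmL ℝ q.1)
    have hsplit (a : E) (w : F →L[ℝ] ℝ) : α (a, w) = α (0, w) + α (a, 0) := by
      simp [← map_add]
    rw [extChartAt_dualBundle htq, hsplit]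
    refine congrArg₂ (· + ·) (hu'.symm.trans ?_) hgq.symm
    rw [linearFunction, hsq, ← t.symmL_apply (R := ℝ) htq]
    rfl

end DualBundle

section Frames

variable {E : Type*} [NormedAddCommGroup E] [NormedSpace ℝ E] [FiniteDimensional ℝ E]
  {M : Type*} [TopologicalSpace M] [ChartedSpace E M] [T2Space M] [IsManifold 𝓘(ℝ, E) ∞ M]
  {F : Type*} [NormedAddCommGroup F] [NormedSpace ℝ F] [FiniteDimensional ℝ F]
  {A : M → Type*} [∀ x, AddCommGroup (A x)] [∀ x, Module ℝ (A x)] [∀ x, TopologicalSpace (A x)]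
  [TopologicalSpace (TotalSpace F A)] [FiberBundle F A] [VectorBundle ℝ F A]
  [ContMDiffVectorBundle ∞ F A 𝓘(ℝ, E)]

variable (F A) in
/-- The basis of the fibre `A x` formed by the values at `x` of the local basis of sections. -/
def frameBasis (x : M) : Module.Basis (Fin (Module.finrank ℝ F)) ℝ (A x) :=
  (trivializationAt F A x).basisAt (Module.finBasis ℝ F)
    (FiberBundle.mem_baseSet_trivializationAt' x)

theorem frameBasis_apply (x : M) (i : Fin (Module.finrank ℝ F)) :
    frameBasis F A x i = frameSection E A x (Module.finBasis ℝ F i) x := by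
  rw [frameSection_self]
  simp [frameBasis, Trivialization.basisAt]

omit [T2Space M] in
theorem frameBasis_repr (x : M) (i : Fin (Module.finrank ℝ F)) (a : A x) :
    (frameBasis F A x).repr a i = dualFrame A x i a := by
  simp [frameBasis, Trivialization.basisAt, dualFrame,
    Trivialization.coe_linearMapAt_of_mem _ (FiberBundle.mem_baseSet_trivializationAt' x)]

theorem sum_dualFrame_smul_frameSection (x : M) (a : A x) :
    ∑ i, dualFrame A x i a • frameSection E A x (Module.finBasis ℝ F i) x = a := by
  simpa only [frameBasis_apply (E := E), frameBasis_repr] using (frameBasis F A x).sum_repr a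

theorem dualFrame_frameSection (x : M) (i j : Fin (Module.finrank ℝ F)) :
    dualFrame A x i (frameSection E A x (Module.finBasis ℝ F j) x) = if i = j then 1 else 0 := by
  rw [← frameBasis_apply, ← frameBasis_repr, Module.Basis.repr_self, Finsupp.single_apply]
  simp only [eq_comm]

theorem eventually_frameSection_eq_localFrame (x : M) :
    ∀ᶠ y in 𝓝 x, y ∈ (trivializationAt F A x).baseSet ∧
      ∀ i, frameSection E A x (Module.finBasis ℝ F i) y =
        (trivializationAt F A x).localFrame (Module.finBasis ℝ F) i y := by
  filter_upwards [(trivializationAt F A x).open_baseSet.eventually_mem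
      (FiberBundle.mem_baseSet_trivializationAt' x),
    Filter.eventually_all.2 fun i => frameSection_eventuallyEq (E := E) (A := A) x
      (Module.finBasis ℝ F i)] with y hy he
  exact ⟨hy, fun i => (he i).trans <| by
    simp [Trivialization.localFrame_apply_of_mem_baseSet _ _ hy, Trivialization.basisAt]⟩

-- The frame only spans near `x`; the bump function `c` makes the expansion of `η` global.
theorem exists_smulSection_eq_sum_frameSection (x : M) (η : GlobalSections E F A) :
    ∃ (c : C^∞⟮𝓘(ℝ, E), M; ℝ⟯) (f : Fin (Module.finrank ℝ F) → C^∞⟮𝓘(ℝ, E), M; ℝ⟯), c x = 1 ∧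
      smulSection c η = ∑ i, smulSection (f i) (frameSection E A x (Module.finBasis ℝ F i)) := by
  have : ContMDiffVectorBundle 1 F A 𝓘(ℝ, E) := .of_le (n := ∞) (by simp)
  let t := trivializationAt F A x
  obtain ⟨b, -, hb⟩ := (SmoothBumpFunction.nhds_basis_tsupport (I := 𝓘(ℝ, E)) x).mem_iff.1
    (eventually_frameSection_eq_localFrame (E := E) (F := F) (A := A) x)
  let f (i : Fin (Module.finrank ℝ F)) (y : M) : ℝ :=
    b y • t.localFrameCoeff 𝓘(ℝ, E) (Module.finBasis ℝ F) i y (η y)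
  have hf (i) : ContMDiff 𝓘(ℝ, E) 𝓘(ℝ, ℝ) ∞ (f i) := contMDiff_of_tsupport fun y hy =>
    b.contMDiffAt.smul <| contMDiffAt_localFrameCoeff _
      (hb (tsupport_smul_subset_left _ _ hy)).1 (η.contMDiff y) i
  refine ⟨⟨b, b.contMDiff⟩, fun i => ⟨f i, hf i⟩, b.eq_one, ?_⟩
  ext y
  rw [← ContMDiffSection.coeAddHom_apply (∑ i, _), map_sum, Finset.sum_apply]
  change b y • η y = ∑ i, f i y • frameSection E A x (Module.finBasis ℝ F i) y
  by_cases hy : b y = 0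
  · simp [f, hy]
  · obtain ⟨hyt, he⟩ := hb (subset_tsupport _ hy)
    conv_lhs => rw [t.eq_sum_localFrameCoeff_smul (I := 𝓘(ℝ, E)) (s := η)
      (b := Module.finBasis ℝ F) hyt, Finset.smul_sum]
    simp only [f, t, he, smul_smul, smul_eq_mul]

theorem eq_zero_of_tensorial {x : M} {D : GlobalSections E F A →+ ℝ}
    (hD : ∀ (f : C^∞⟮𝓘(ℝ, E), M; ℝ⟯) (η : GlobalSections E F A), D (smulSection f η) = f x * D η)
    (h : ∀ i, D (frameSection E A x (Module.finBasis ℝ F i)) = 0) (η : GlobalSections E F A) :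
    D η = 0 := by
  obtain ⟨c, f, hc, hη⟩ := exists_smulSection_eq_sum_frameSection x η
  calc D η = D (smulSection c η) := by rw [hD, hc, one_mul]
    _ = ∑ i, f i x * D (frameSection E A x (Module.finBasis ℝ F i)) := by
      simp only [hη, map_sum, hD]
    _ = 0 := by simp only [h, mul_zero, Finset.sum_const_zero]

theorem eq_zero_of_tensorial_of_antisymm {x : M}
    {B : GlobalSections E F A → GlobalSections E F A → ℝ}
    (hadd : ∀ μ μ' η, B (μ + μ') η = B μ η + B μ' η)
    (hsmul : ∀ (f : C^∞⟮𝓘(ℝ, E), M; ℝ⟯) μ η, B (smulSection f μ) η = f x * B μ η)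
    (hswap : ∀ μ η, B μ η = -B η μ)
    (h : ∀ i j, B (frameSection E A x (Module.finBasis ℝ F i))
      (frameSection E A x (Module.finBasis ℝ F j)) = 0) (μ η : GlobalSections E F A) :
    B μ η = 0 := by
  let D (η) : GlobalSections E F A →+ ℝ := .mk' (B · η) fun μ μ' => hadd μ μ' η
  have hframe (j) (μ) : B μ (frameSection E A x (Module.finBasis ℝ F j)) = 0 :=
    eq_zero_of_tensorial (D := D _) (fun f η => hsmul f η _) (h · j) μ
  exact eq_zero_of_tensorial (D := D η) (fun f μ => hsmul f μ η)
    (fun i => by rw [AddMonoidHom.mk'_apply, hswap, hframe, neg_zero]) μ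

end Frames

theorem sum_Ioi_mul_ite_sub_ite_of_antisymm {n : ℕ} {c : Fin n → Fin n → ℝ}
    (hc : ∀ i j, c i j = -c j i) (k l : Fin n) :
    ∑ i, ∑ j ∈ Finset.Ioi i, c i j * ((if i = k then 1 else 0) * (if j = l then 1 else 0) -
      (if j = k then 1 else 0) * (if i = l then 1 else 0)) = c k l := by
  have hrow (i : Fin n) : ∑ j ∈ Finset.Ioi i, c i j *
      ((if i = k then 1 else 0) * (if j = l then 1 else 0) -
        (if j = k then 1 else 0) * (if i = l then 1 else 0)) =
      (if i = k then (if i < l then c i l else 0) else 0) -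
      (if i = l then (if i < k then c i k else 0) else 0) := by
    simp only [mul_sub, Finset.sum_sub_distrib]
    congr 1
    · by_cases hi : i = k <;> simp [hi]
    · by_cases hi : i = l <;> simp [hi]
  simp only [hrow, Finset.sum_sub_distrib, Finset.sum_ite_eq', Finset.mem_univ, if_true]
  rcases lt_trichotomy k l with hkl | rfl | hkl
  · simp [hkl, hkl.not_gt]
  · simp [self_eq_neg.1 (hc k k)]
  · simp [hkl, hkl.not_gt, hc k l]

section Algebroid

variable {E : Type*} [NormedAddCommGroup E] [NormedSpace ℝ E]
  {M : Type*} [TopologicalSpace M] [ChartedSpace E M]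
  {F : Type*} [NormedAddCommGroup F] [NormedSpace ℝ F]
  {A : M → Type*} [∀ x, AddCommGroup (A x)] [∀ x, Module ℝ (A x)] [∀ x, TopologicalSpace (A x)]
  [TopologicalSpace (TotalSpace F A)] [FiberBundle F A] [VectorBundle ℝ F A]

theorem linearFunction_add (μ η : GlobalSections E F A) :
    linearFunction (μ + η) = linearFunction μ + linearFunction η :=
  funext fun p => map_add p.2 _ _

theorem linearFunction_smulSection (f : C^∞⟮𝓘(ℝ, E), M; ℝ⟯) (μ : GlobalSections E F A) :
    linearFunction (smulSection f μ) = basicFunction F A f * linearFunction μ :=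
  funext fun p => map_smul p.2 (f p.1) (μ p.1)

namespace LieAlgebroid

variable [IsManifold 𝓘(ℝ, E) ∞ M] (L : LieAlgebroid E F A) (φ : DualSections E F A)

theorem bracket_swap (μ η : GlobalSections E F A) : L.bracket μ η = -L.bracket η μ := by
  have h := L.bracket_self (μ + η)
  simp only [map_add, LinearMap.add_apply, L.bracket_self, zero_add, add_zero] at h
  exact eq_neg_of_add_eq_zero_right h

theorem contMDiff_anchor (μ : GlobalSections E F A) : ContMDiff 𝓘(ℝ, E) 𝓘(ℝ, E).tangent ∞
    (fun y => (⟨y, L.anchor y (μ y)⟩ : TangentBundle 𝓘(ℝ, E) M)) :=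
  L.anchor_smooth.comp μ.contMDiff

/-- The derivation `f ↦ ρ(μ)(f)` of the smooth functions on the base. -/
def anchorDerivation (μ : GlobalSections E F A) :
    Derivation ℝ C^∞⟮𝓘(ℝ, E), M; ℝ⟯ C^∞⟮𝓘(ℝ, E), M; ℝ⟯ :=
  let X := fun y => L.anchor y (μ y)
  have hd (f : C^∞⟮𝓘(ℝ, E), M; ℝ⟯) (x : M) : MDifferentiableAt 𝓘(ℝ, E) 𝓘(ℝ, ℝ) f x :=
    (f.contMDiff x).mdifferentiableAt (by simp)
  Derivation.mk'
    { toFun := fun f =>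
        ⟨along 𝓘(ℝ, E) X f, contMDiff_along (L.contMDiff_anchor μ) f.contMDiff⟩
      map_add' := fun f g => ContMDiffMap.ext fun x => along_add (X := X) (hd f x) (hd g x)
      map_smul' := fun c f => ContMDiffMap.ext fun x => along_const_smul (X := X) c (hd f x) }
    fun f g => ContMDiffMap.ext fun x => along_mul (X := X) (hd f x) (hd g x)

theorem anchorDerivation_apply (μ : GlobalSections E F A) (f : C^∞⟮𝓘(ℝ, E), M; ℝ⟯) (x : M) :
    L.anchorDerivation μ f x = mvfderiv 𝓘(ℝ, E) f x (L.anchor x (μ x)) := rfl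

theorem anchorDerivation_bracket [FiniteDimensional ℝ E] (μ η : GlobalSections E F A) :
    L.anchorDerivation (L.bracket μ η) = ⁅L.anchorDerivation μ, L.anchorDerivation η⁆ := by
  ext f x
  have h := mvfderiv_mlieBracket (L.contMDiff_anchor μ) (L.contMDiff_anchor η) f.contMDiff x
  rw [← L.anchor_bracket] at h
  exact h

theorem bracket_smulSection_left (f : C^∞⟮𝓘(ℝ, E), M; ℝ⟯) (μ η : GlobalSections E F A) (x : M) :
    L.bracket (smulSection f μ) η x =
      f x • L.bracket μ η x - L.anchorDerivation η f x • μ x := by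
  rw [L.bracket_swap, ContMDiffSection.coe_neg, Pi.neg_apply, L.leibniz, L.bracket_swap μ,
    ContMDiffSection.coe_neg, Pi.neg_apply, smul_neg, neg_add', anchorDerivation_apply]

/-- The first-order operator `f ↦ ρ(μ)(f) + φ(μ) f`. For a 1-cocycle `φ` it is a representation of
the Lie algebra `Γ(A)` on `C^∞(M)`. -/
def twistedAnchor (μ : GlobalSections E F A) : Module.End ℝ C^∞⟮𝓘(ℝ, E), M; ℝ⟯ :=
  L.anchorDerivation μ + LinearMap.mulLeft ℝ (dualApply φ μ)

variable {L φ} in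
theorem IsCocycle.dualApply_bracket (hφ : L.IsCocycle φ) (μ η : GlobalSections E F A) :
    dualApply φ (L.bracket μ η) =
      L.anchorDerivation μ (dualApply φ η) - L.anchorDerivation η (dualApply φ μ) :=
  ContMDiffMap.ext (hφ μ η)

variable {L φ} in
theorem IsCocycle.twistedAnchor_bracket [FiniteDimensional ℝ E] (hφ : L.IsCocycle φ)
    (μ η : GlobalSections E F A) :
    L.twistedAnchor φ (L.bracket μ η) = ⁅L.twistedAnchor φ μ, L.twistedAnchor φ η⁆ := by
  ext1 f
  simp only [twistedAnchor, L.anchorDerivation_bracket, hφ.dualApply_bracket, LinearMap.add_apply,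
    LinearMap.mulLeft_apply, LieRing.of_associative_ring_bracket, LinearMap.sub_apply,
    Module.End.mul_apply, Derivation.coeFn_coe, Derivation.commutator_apply, map_add,
    Derivation.leibniz, smul_eq_mul]
  ring

/-- The bracket of the semidirect product of `Γ(A)` with `C^∞(M)`, on which `Γ(A)` acts by
`twistedAnchor`. -/
def semidirectBracket (s t : GlobalSections E F A × C^∞⟮𝓘(ℝ, E), M; ℝ⟯) :
    GlobalSections E F A × C^∞⟮𝓘(ℝ, E), M; ℝ⟯ :=
  (L.bracket s.1 t.1, L.twistedAnchor φ s.1 t.2 - L.twistedAnchor φ t.1 s.2)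

theorem jacobi_left (μ η ν : GlobalSections E F A) :
    L.bracket (L.bracket μ η) ν + L.bracket (L.bracket η ν) μ +
      L.bracket (L.bracket ν μ) η = 0 := by
  rw [L.bracket_swap (L.bracket μ η) ν, L.bracket_swap (L.bracket η ν) μ,
    L.bracket_swap (L.bracket ν μ) η, add_assoc, add_comm, ← neg_add, ← neg_add, L.jacobi, neg_zero]

variable {L φ} in
theorem IsCocycle.semidirectBracket_jacobi [FiniteDimensional ℝ E] (hφ : L.IsCocycle φ)
    (s t u : GlobalSections E F A × C^∞⟮𝓘(ℝ, E), M; ℝ⟯) :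
    L.semidirectBracket φ (L.semidirectBracket φ s t) u +
      L.semidirectBracket φ (L.semidirectBracket φ t u) s +
      L.semidirectBracket φ (L.semidirectBracket φ u s) t = 0 := by
  refine Prod.ext (L.jacobi_left s.1 t.1 u.1) ?_
  simp only [semidirectBracket, Prod.snd_add, Prod.snd_zero, hφ.twistedAnchor_bracket,
    LieRing.of_associative_ring_bracket, LinearMap.sub_apply, Module.End.mul_apply, map_sub]
  abel

variable {L φ} in
theorem jacobiBracket_affineFunction {Λ : ∀ p : DualBundle F A, CotangentForm (dualModel E F) p}
    {X : ∀ p : DualBundle F A, TangentSpace (dualModel E F) p} (hΛ₀ : ∀ p α, Λ p α α = 0)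
    (hll : ∀ μ η : GlobalSections E F A, jacobiBracket (dualModel E F) Λ X (linearFunction μ)
      (linearFunction η) = linearFunction (L.bracket μ η))
    (hlb : ∀ (μ : GlobalSections E F A) (f : C^∞⟮𝓘(ℝ, E), M; ℝ⟯),
      jacobiBracket (dualModel E F) Λ X (linearFunction μ) (basicFunction F A f) =
        basicFunction F A (L.twistedAnchor φ μ f))
    (hbb : ∀ f g : C^∞⟮𝓘(ℝ, E), M; ℝ⟯, jacobiBracket (dualModel E F) Λ X (basicFunction F A f)
      (basicFunction F A g) = 0)
    (s t : GlobalSections E F A × C^∞⟮𝓘(ℝ, E), M; ℝ⟯) :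
    jacobiBracket (dualModel E F) Λ X (affineFunction s) (affineFunction t) =
      affineFunction (L.semidirectBracket φ s t) := by
  have hl (μ : GlobalSections E F A) := mdifferentiableAt_linearFunction μ
  have hb (f : C^∞⟮𝓘(ℝ, E), M; ℝ⟯) := mdifferentiableAt_basicFunction (A := A) (F := F) f.contMDiff
  rw [affineFunction_apply s, affineFunction_apply t, jacobiBracket_add_left (hl _) (hb _),
    jacobiBracket_add_right hΛ₀ (hl _) (hb _), jacobiBracket_add_right hΛ₀ (hl _) (hb _),
    jacobiBracket_swap hΛ₀ (basicFunction F A s.2), hll, hlb, hlb, hbb, add_zero, add_assoc,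
    ← sub_eq_add_neg]
  rfl

variable {L φ} in
theorem IsInducedBy.bracket_affineFunction [ContMDiffVectorBundle ∞ F A 𝓘(ℝ, E)]
    {J : JacobiStructure (dualModel E F) (DualBundle F A)} (hJ : L.IsInducedBy φ J)
    (s t : GlobalSections E F A × C^∞⟮𝓘(ℝ, E), M; ℝ⟯) :
    J.bracket (affineFunction s) (affineFunction t) =
      affineFunction (L.semidirectBracket φ s t) :=
  jacobiBracket_affineFunction J.bivec_self hJ.linear_linear hJ.linear_basic hJ.basic_basic s t

variable [FiniteDimensional ℝ E] [T2Space M] [FiniteDimensional ℝ F]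
  [ContMDiffVectorBundle ∞ F A 𝓘(ℝ, E)]

theorem linearPoisson_apply (p : DualBundle F A) (α β : Cotangent (dualModel E F) p) :
    L.linearPoisson p α β =
      ∑ i, ∑ j ∈ Finset.Ioi i, p.2 (L.bracket (frameSection E A p.1 (Module.finBasis ℝ F i))
          (frameSection E A p.1 (Module.finBasis ℝ F j)) p.1) *
        wedgeVec (dualModel E F) (verticalVec E p (dualFrame A p.1 i))
          (verticalVec E p (dualFrame A p.1 j)) α β +
      ∑ i, wedgeVec (dualModel E F) (verticalVec E p (dualFrame A p.1 i))
        (coordVec p (L.anchor p.1 (frameSection E A p.1 (Module.finBasis ℝ F i) p.1))) α β := by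
  simp only [linearPoisson, add_apply, sum_apply, smul_apply, smul_eq_mul]

theorem linearPoisson_self (p : DualBundle F A) (α : Cotangent (dualModel E F) p) :
    L.linearPoisson p α α = 0 := by
  simp [linearPoisson_apply, wedgeVec_apply, mul_comm]

theorem linearPoisson_basic_basic {f g : M → ℝ} (hf : ContMDiff 𝓘(ℝ, E) 𝓘(ℝ, ℝ) ∞ f)
    (hg : ContMDiff 𝓘(ℝ, E) 𝓘(ℝ, ℝ) ∞ g) :
    pairing (dualModel E F) L.linearPoisson (basicFunction F A f) (basicFunction F A g) = 0 := by
  funext p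
  simp [pairing, linearPoisson_apply, wedgeVec_apply, mvfderiv_basicFunction_verticalVec hf,
    mvfderiv_basicFunction_verticalVec hg]

theorem linearPoisson_linear_basic (μ : GlobalSections E F A) (f : C^∞⟮𝓘(ℝ, E), M; ℝ⟯) :
    pairing (dualModel E F) L.linearPoisson (linearFunction μ) (basicFunction F A f) =
      basicFunction F A (L.anchorDerivation μ f) := by
  funext p
  simp only [pairing, linearPoisson_apply, wedgeVec_apply,
    mvfderiv_basicFunction_verticalVec f.contMDiff, mvfderiv_basicFunction_coordVec f.contMDiff,
    mvfderiv_linearFunction_verticalVec, mul_zero, sub_zero, Finset.sum_const_zero, zero_add]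
  rw [basicFunction, anchorDerivation_apply]
  conv_rhs => rw [← sum_dualFrame_smul_frameSection (E := E) (F := F) p.1 (μ p.1), map_sum, map_sum]
  simp only [map_smul, smul_eq_mul]

theorem linearPoisson_frame_frame (p : DualBundle F A) (k l : Fin (Module.finrank ℝ F)) :
    pairing (dualModel E F) L.linearPoisson
      (linearFunction (frameSection E A p.1 (Module.finBasis ℝ F k)))
      (linearFunction (frameSection E A p.1 (Module.finBasis ℝ F l))) p =
    p.2 (L.bracket (frameSection E A p.1 (Module.finBasis ℝ F k))
      (frameSection E A p.1 (Module.finBasis ℝ F l)) p.1) := by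
  have hswap (i j) : p.2 (L.bracket (frameSection E A p.1 (Module.finBasis ℝ F i))
      (frameSection E A p.1 (Module.finBasis ℝ F j)) p.1) =
      -p.2 (L.bracket (frameSection E A p.1 (Module.finBasis ℝ F j))
      (frameSection E A p.1 (Module.finBasis ℝ F i)) p.1) := by
    rw [L.bracket_swap, ContMDiffSection.coe_neg, Pi.neg_apply, map_neg]
  refine Eq.trans ?_ (sum_Ioi_mul_ite_sub_ite_of_antisymm hswap k l)
  simp only [pairing, linearPoisson_apply, wedgeVec_apply, mvfderiv_linearFunction_verticalVec,
    mvfderiv_linearFunction_frameSection_coordVec, dualFrame_frameSection, mul_zero, zero_mul,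
    sub_zero, Finset.sum_const_zero, add_zero]

theorem linearPoisson_smulSection_linear (f : C^∞⟮𝓘(ℝ, E), M; ℝ⟯) (μ η : GlobalSections E F A)
    (p : DualBundle F A) :
    pairing (dualModel E F) L.linearPoisson (linearFunction (smulSection f μ))
        (linearFunction η) p =
      f p.1 * pairing (dualModel E F) L.linearPoisson (linearFunction μ) (linearFunction η) p -
        L.anchorDerivation η f p.1 * p.2 (μ p.1) := by
  rw [linearFunction_smulSection,
    pairing_mul_left (mdifferentiableAt_basicFunction f.contMDiff p)
      (mdifferentiableAt_linearFunction μ p),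
    pairing_swap L.linearPoisson_self (basicFunction F A f), linearPoisson_linear_basic,
    Pi.neg_apply]
  simp only [basicFunction, linearFunction]
  ring

-- Neither side is tensorial in `μ` and `η`, but their difference is, so that it can be computed on
-- the frame defining `linearPoisson`.
theorem linearPoisson_linear_linear (μ η : GlobalSections E F A) :
    pairing (dualModel E F) L.linearPoisson (linearFunction μ) (linearFunction η) =
      linearFunction (L.bracket μ η) := by
  funext p
  refine sub_eq_zero.1 (eq_zero_of_tensorial_of_antisymm (x := p.1)
    (B := fun μ η => pairing (dualModel E F) L.linearPoisson (linearFunction μ)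
      (linearFunction η) p - linearFunction (L.bracket μ η) p) ?_ ?_ ?_ ?_ μ η)
  · intro μ μ' η
    rw [linearFunction_add, pairing_add_left (mdifferentiableAt_linearFunction μ p)
      (mdifferentiableAt_linearFunction μ' p), map_add, LinearMap.add_apply, linearFunction_add,
      Pi.add_apply]
    ring
  · intro f μ η
    rw [linearPoisson_smulSection_linear, linearFunction, bracket_smulSection_left, map_sub,
      map_smul, map_smul, linearFunction, smul_eq_mul, smul_eq_mul]
    ring
  · intro μ η
    rw [pairing_swap L.linearPoisson_self, L.bracket_swap, linearFunction, linearFunction,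
      ContMDiffSection.coe_neg, Pi.neg_apply, Pi.neg_apply, map_neg]
    ring
  · exact fun i j => sub_eq_zero.2 (L.linearPoisson_frame_frame p i j)

/-- The bivector field `Λ_{A*} + Δ ∧ φ^v`. -/
def jacobiBivec (p : DualBundle F A) : CotangentForm (dualModel E F) p :=
  L.linearPoisson p + wedgeVec (dualModel E F) (liouville p) (verticalLift φ p)

theorem jacobiBivec_self (p : DualBundle F A) (α : Cotangent (dualModel E F) p) :
    L.jacobiBivec φ p α α = 0 := by
  simp only [jacobiBivec, add_apply, linearPoisson_self, wedgeVec_apply]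
  ring

theorem jacobiBracket_jacobiBivec (f g : DualBundle F A → ℝ) (p : DualBundle F A) :
    jacobiBracket (dualModel E F) (L.jacobiBivec φ) (fun p => -verticalLift φ p) f g p =
      pairing (dualModel E F) L.linearPoisson f g p +
        (mvfderiv (dualModel E F) f p (liouville p) - f p) *
          mvfderiv (dualModel E F) g p (verticalLift φ p) -
        (mvfderiv (dualModel E F) g p (liouville p) - g p) *
          mvfderiv (dualModel E F) f p (verticalLift φ p) := by
  simp only [jacobiBracket, pairing, along, jacobiBivec, wedgeVec_apply, Pi.add_apply,
    Pi.sub_apply, Pi.mul_apply, add_apply, map_neg]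
  ring

theorem jacobiBracket_linear_linear (μ η : GlobalSections E F A) :
    jacobiBracket (dualModel E F) (L.jacobiBivec φ) (fun p => -verticalLift φ p)
      (linearFunction μ) (linearFunction η) = linearFunction (L.bracket μ η) := by
  funext p
  rw [jacobiBracket_jacobiBivec]
  simp only [linearPoisson_linear_linear, liouville, mvfderiv_linearFunction_verticalVec]
  simp only [linearFunction, sub_self, zero_mul, add_zero, sub_zero]

theorem jacobiBracket_linear_basic (μ : GlobalSections E F A) (f : C^∞⟮𝓘(ℝ, E), M; ℝ⟯) :
    jacobiBracket (dualModel E F) (L.jacobiBivec φ) (fun p => -verticalLift φ p)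
      (linearFunction μ) (basicFunction F A f) = basicFunction F A (L.twistedAnchor φ μ f) := by
  funext p
  rw [jacobiBracket_jacobiBivec]
  simp only [linearPoisson_linear_basic, liouville, verticalLift,
    mvfderiv_linearFunction_verticalVec, mvfderiv_basicFunction_verticalVec f.contMDiff, mul_zero,
    add_zero, zero_sub, neg_mul, sub_neg_eq_add]
  exact congrArg _ (mul_comm _ _)

theorem jacobiBracket_basic_basic (f g : C^∞⟮𝓘(ℝ, E), M; ℝ⟯) :
    jacobiBracket (dualModel E F) (L.jacobiBivec φ) (fun p => -verticalLift φ p)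
      (basicFunction F A f) (basicFunction F A g) = 0 := by
  funext p
  rw [jacobiBracket_jacobiBivec]
  simp only [linearPoisson_basic_basic _ f.contMDiff g.contMDiff,
    verticalLift, mvfderiv_basicFunction_verticalVec f.contMDiff,
    mvfderiv_basicFunction_verticalVec g.contMDiff, mul_zero, add_zero, sub_zero]

variable {L φ}

theorem IsInducedBy.unique {J J' : JacobiStructure (dualModel E F) (DualBundle F A)}
    (hJ : L.IsInducedBy φ J) (hJ' : L.IsInducedBy φ J') : J = J' := by
  refine generatesCoordinates_range_affineFunction.jacobiStructure_ext
    one_mem_range_affineFunction ?_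
  rintro _ ⟨s, rfl⟩ _ ⟨t, rfl⟩
  rw [hJ.bracket_affineFunction, hJ'.bracket_affineFunction]

theorem jacobiBracket_jacobiBivec_affineFunction
    (s t : GlobalSections E F A × C^∞⟮𝓘(ℝ, E), M; ℝ⟯) :
    jacobiBracket (dualModel E F) (L.jacobiBivec φ) (fun p => -verticalLift φ p)
      (affineFunction s) (affineFunction t) = affineFunction (L.semidirectBracket φ s t) :=
  jacobiBracket_affineFunction (L.jacobiBivec_self φ) (L.jacobiBracket_linear_linear φ)
    (L.jacobiBracket_linear_basic φ) (L.jacobiBracket_basic_basic φ) s t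

/-- The Jacobi structure `(Λ_{A*} + Δ ∧ φ^v, -φ^v)` on `A*` of a Lie algebroid with a
1-cocycle `φ`. -/
def IsCocycle.jacobiStructure (hφ : L.IsCocycle φ) :
    JacobiStructure (dualModel E F) (DualBundle F A) :=
  .ofGenerators (L.jacobiBivec φ) (fun p => -verticalLift φ p) (L.jacobiBivec_self φ)
    generatesCoordinates_range_affineFunction one_mem_range_affineFunction
    (by
      rintro _ ⟨s, rfl⟩ _ ⟨t, rfl⟩
      rw [jacobiBracket_jacobiBivec_affineFunction]
      exact contMDiff_affineFunction _)
    (by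
      rintro _ ⟨s, rfl⟩ _ ⟨t, rfl⟩ _ ⟨u, rfl⟩ p
      simp only [jacobiBracket_jacobiBivec_affineFunction]
      rw [← Pi.add_apply, ← Pi.add_apply, ← map_add, ← map_add, hφ.semidirectBracket_jacobi,
        map_zero, Pi.zero_apply])

theorem IsCocycle.isInducedBy_jacobiStructure (hφ : L.IsCocycle φ) :
    L.IsInducedBy φ hφ.jacobiStructure :=
  ⟨L.jacobiBracket_linear_linear φ, L.jacobiBracket_linear_basic φ, L.jacobiBracket_basic_basic φ⟩

end LieAlgebroid

end Algebroid

end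

theorem theorem1
    {E : Type*} [NormedAddCommGroup E] [NormedSpace ℝ E] [FiniteDimensional ℝ E]
    {M : Type*} [TopologicalSpace M] [ChartedSpace E M] [T2Space M] [IsManifold 𝓘(ℝ, E) ∞ M]
    {F : Type*} [NormedAddCommGroup F] [NormedSpace ℝ F] [FiniteDimensional ℝ F]
    {A : M → Type*} [∀ x, AddCommGroup (A x)] [∀ x, Module ℝ (A x)]
    [∀ x, TopologicalSpace (A x)] [TopologicalSpace (TotalSpace F A)] [FiberBundle F A]
    [VectorBundle ℝ F A] [ContMDiffVectorBundle ∞ F A 𝓘(ℝ, E)]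
    (L : LieAlgebroid E F A) (φ : DualSections E F A) (hφ : L.IsCocycle φ) :
    ∃ J : JacobiStructure (dualModel E F) (DualBundle F A),
      L.IsInducedBy φ J ∧
      (∀ J' : JacobiStructure (dualModel E F) (DualBundle F A), L.IsInducedBy φ J' → J' = J) ∧
      (∀ p, J.bivec p =
        L.linearPoisson p + wedgeVec (dualModel E F) (liouville p) (verticalLift φ p)) ∧
      (∀ p, J.vec p = -verticalLift φ p) :=
  ⟨hφ.jacobiStructure, hφ.isInducedBy_jacobiStructure,
    fun _ hJ' => hJ'.unique hφ.isInducedBy_jacobiStructure, fun _ => rfl, fun _ => rfl⟩
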